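/- **Setting.** Let $\mathbb K=\mathbb R$ or $\mathbb C$ and let $\sigma\in\{+1,-1\}$. Let $N$ be (a coordinate domain of) a 3-manifold over $\mathbb K$ with a point $i\in N$, carrying smooth (for $\mathbb K=\mathbb C$: holomorphic) fields: a non-degenerate symmetric metric $h_{ab}$, functions $\phi,\Omega,R$, and a symmetric tensor $S_{ab}$ with $h^{ab}S_{ab}=0$, with values in $\mathbb K$. Let $D$ be the Levi-Civita connection of $h$, $R_{ab}[h]$ its Ricci tensor (positive on round spheres), indices be raised with $h$, $\Delta=D^aD_a$, and suppose that $Q:=1+\Omega-\phi^2$ has no zero on $N$. For covectors $u,v$ write $\langle u,v\rangle=h^{ab}u_av_b$. Round and square brackets around indices denote symmetrization and antisymmetrization, with factor $\tfrac1{n!}$. The fields are a *solution of the conformal stationary vacuum field equations* if on $N$ $$R_{ab}[h]=S_{ab}+\tfrac13h_{ab}R,$$ $$\Delta\phi=-\phi\Big\{\tfrac12R+\tfrac5Q\big[\tfrac14\phi^2\langle D\Omega,D\Omega\rangle-(1+\Omega)\phi\langle D\Omega,D\phi\rangle+(1+\Omega)^2\langle D\phi,D\phi\rangle\big]\Big\},$$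 $$\begin{aligned}D_aD_b\Omega=&-\Omega S_{ab}-\tfrac13(1+\Omega)h_{ab}R+\tfrac1Q\Big\{\tfrac12[1+(-1+\Omega)\phi^2]D_a\Omega D_b\Omega-\tfrac13(2+3\Omega)\phi^2h_{ab}\langle D\Omega,D\Omega\rangle-2\Omega^2\phi D_{(a}\Omega D_{b)}\phi\\&+\tfrac43(1+\Omega)(2+3\Omega)\phi h_{ab}\langle D\Omega,D\phi\rangle+2\Omega^2(1+\Omega)D_a\phi D_b\phi-\tfrac43(1+\Omega)^2(2+3\Omega)h_{ab}\langle D\phi,D\phi\rangle\Big\},\end{aligned}$$ $$\begin{aligned}D_aR=&\tfrac1Q\Big\{2(4+7\Omega)\phi D^b\Omega D_bD_a\phi-4(1+\Omega)(4+7\Omega)D^b\phi D_bD_a\phi+[3+(-3+7\Omega)\phi^2]D^b\Omega S_{ba}\\&-2\Omega(4+7\Omega)\phi D^b\phi S_{ba}+\tfrac13(4+7\Omega)\phi^2RD_a\Omega-\tfrac23(1+\Omega)(4+7\Omega)\phi RD_a\phi\Big\}\\&+\tfrac1{3Q^2}\Big\{\tfrac12\phi^2[-12+(40+21\Omega)\phi^2]\langle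 D\Omega,D\Omega\rangle D_a\Omega-2\phi[-18(1+\Omega)+(46+61\Omega+21\Omega^2)\phi^2]\langle D\Omega,D\phi\rangle D_a\Omega\\&+2(1+\Omega)[-24(1+\Omega)+(52+61\Omega+21\Omega^2)\phi^2]\langle D\phi,D\phi\rangle D_a\Omega-\phi[12(1+\Omega)+(16+61\Omega+21\Omega^2)\phi^2]\langle D\Omega,D\Omega\rangle D_a\phi\\&+4(1+\Omega)[6(1+\Omega)+(22+61\Omega+21\Omega^2)\phi^2]\langle D\Omega,D\phi\rangle D_a\phi-4(1+\Omega)^2(28+61\Omega+21\Omega^2)\phi\langle D\phi,D\phi\rangle D_a\phi\Big\},\end{aligned}$$ $$\begin{aligned}D_{[c}S_{b]a}=&\tfrac1Q\Big\{\Omega\phi D_aD_{[b}\phi D_{c]}\Omega-2\Omega(1+\Omega)D_aD_{[b}\phi D_{c]}\phi-\tfrac23(1+\Omega)\phi h_{a[b}D_{c]}D_d\phi D^d\Omega+\tfrac43(1+\Omega)^2h_{a[b}D_{c]}D_d\phi D^d\phi\\&+\tfrac12[1+(-1+\Omega)\phi^2]S_{a[b}D_{c]}\Omega-\Omega^2\phi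 S_{a[b}D_{c]}\phi-\tfrac13\Omega\phi^2h_{a[b}S_{c]d}D^d\Omega+\tfrac23\Omega(1+\Omega)\phi h_{a[b}S_{c]d}D^d\phi\\&+\tfrac1{18}(-2+\Omega)\phi^2Rh_{a[b}D_{c]}\Omega-\tfrac19(-2+\Omega)(1+\Omega)\phi Rh_{a[b}D_{c]}\phi+2\phi D_a\Omega D_{[b}\Omega D_{c]}\phi-4(1+\Omega)D_a\phi D_{[b}\Omega D_{c]}\phi\Big\}\\&+\tfrac1{9Q^2}\Big\{\tfrac12\phi^2[3+2(-5+3\Omega)\phi^2]h_{a[b}D_{c]}\Omega\langle D\Omega,D\Omega\rangle-\phi[6(1+\Omega)+(-13-4\Omega+6\Omega^2)\phi^2]h_{a[b}D_{c]}\phi\langle D\Omega,D\Omega\rangle\\&-2(-7-4\Omega+6\Omega^2)\phi^3h_{a[b}D_{c]}\Omega\langle D\Omega,D\phi\rangle+4(1+\Omega)^2[3+2(-5+3\Omega)\phi^2]h_{a[b}D_{c]}\phi\langle D\Omega,D\phi\rangle\\&+2(1+\Omega)[-3(1+\Omega)+(-4-4\Omega+6\Omega^2)\phi^2]h_{a[b}D_{c]}\Omega\langle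 D\phi,D\phi\rangle-4(1+\Omega)^2(-7-4\Omega+6\Omega^2)\phi h_{a[b}D_{c]}\phi\langle D\phi,D\phi\rangle\Big\},\end{aligned}$$ and at the point $i$ $$\phi=0,\qquad\Omega=0,\quad D_a\Omega=0,\quad D_aD_b\Omega=2h_{ab},\qquad R=-(6+8D^a\phi D_a\phi).$$ A *normal frame centered at $i$* is a smooth frame field $c_{\mathbf a}$, $\mathbf a=1,2,3$, on $N$ with $h(c_{\mathbf a},c_{\mathbf b})=\sigma\delta_{\mathbf{ab}}$ that is parallel along the geodesics through $i$. Let $\alpha^{a}{}_{AB}$ ($A,B=0,1$) be the symbols $\alpha^1=\tfrac1{\sqrt2}\begin{pmatrix}-1&0\\0&1\end{pmatrix}$, $\alpha^2=\tfrac1{\sqrt2}\begin{pmatrix}\mathrm i&0\\0&\mathrm i\end{pmatrix}$, $\alpha^3=\tfrac1{\sqrt2}\begin{pmatrix}0&1\\1&0\end{pmatrix}$. The spinor of a tensor with frame components $T_{\mathbf a_1\dots\mathbf a_p}$ is $T_{A_1B_1\dots A_pB_p}=T_{\mathbf a_1\dots\mathbf a_p}\alpha^{a_1}{}_{A_1B_1}\cdots\alpha^{a_p}{}_{A_pB_p}$;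 in particular $D_{A_pB_p}\cdots D_{A_1B_1}f$ denotes the spinor of the $p$-th covariant derivative of $f$. A spinor with $p$ index pairs satisfies the *reality condition* if $T_{A_1B_1\dots A_pB_p}=(-1)^p\,\tau_{A_1}{}^{A_1'}\tau_{B_1}{}^{B_1'}\cdots\tau_{A_p}{}^{A_p'}\tau_{B_p}{}^{B_p'}\,\overline{T_{A_1'B_1'\dots A_p'B_p'}}$, where $\tau_0{}^1=-1$, $\tau_1{}^0=1$, $\tau_0{}^0=\tau_1{}^1=0$. **Lemma.** Fix $\mathbb K$ and $\sigma$. Let $\psi_{A_pB_p\dots A_1B_1}$ ($p\ge1$) and $\Psi_{A_pB_p\dots A_1B_1}$ ($p\ge2$) be two sequences of totally symmetric spinors satisfying the reality condition. Assume that there is a solution $h,\phi,\Omega,R,S$ of the conformal stationary vacuum field equations with the above conditions at $i$, and a normal frame centered at $i$, whose null data are the given sequences, i.e. at $i$ $$\psi_{A_pB_p\dots A_1B_1}=D_{(A_pB_p}\cdots D_{A_1B_1)}\phi\ \ (p\ge1),\qquad\Psi_{A_pB_p\dots A_1B_1}=D_{(A_pB_p}\cdots D_{A_3B_3}S_{A_2B_2A_1B_1)}\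 \ (p\ge2).$$ Then for every $p\ge0$ the normal expansion coefficients at $i$ $$D_{A_pB_p}\cdots D_{A_1B_1}\phi,\quad D_{A_pB_p}\cdots D_{A_1B_1}\Omega,\quad D_{A_pB_p}\cdots D_{A_1B_1}R,\quad D_{A_pB_p}\cdots D_{A_1B_1}S_{ABCD}$$ are uniquely determined by the two sequences (any two such solutions with such frames, over the same $\mathbb K$, with the same $\sigma$ and the same null data, have the same coefficients), and all of them satisfy the reality condition. -/

import Mathlib

open scoped ContDiff

noncomputable section

namespace ConfStat

/-! ### Tensor calculus in a coordinate chart of a 3-manifold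

The ground field `𝕜` is `ℝ` (real smooth fields) or `ℂ` (holomorphic fields). -/

section Tensor

variable {𝕜 : Type*} [RCLike 𝕜]

/-- Points of the coordinate chart. -/
abbrev Pt (𝕜 : Type*) := Fin 3 → 𝕜

/-- Covariant tensor fields of rank `k`, through their coordinate components. -/
abbrev TensorField (𝕜 : Type*) (k : ℕ) := Pt 𝕜 → (Fin k → Fin 3) → 𝕜

/-- The partial derivative `∂_a f` at `x`. -/
def pd (f : Pt 𝕜 → 𝕜) (a : Fin 3) (x : Pt 𝕜) : 𝕜 :=
  fderiv 𝕜 f x (Pi.single a 1)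

/-- The Christoffel symbols `Γ^d_{ab}` of the Levi-Civita connection of `h`. -/
def christoffel (h : Pt 𝕜 → Matrix (Fin 3) (Fin 3) 𝕜) (x : Pt 𝕜) (d a b : Fin 3) : 𝕜 :=
  (1 / 2) * ∑ e, (h x)⁻¹ d e *
    (pd (fun y => h y b e) a x + pd (fun y => h y a e) b x - pd (fun y => h y a b) e x)

/-- The covariant derivative; the new index is put in front:
`(D T)_{a b₁ … b_k} = D_a T_{b₁ … b_k}`. -/
def covDeriv (h : Pt 𝕜 → Matrix (Fin 3) (Fin 3) 𝕜) {k : ℕ} (T : TensorField 𝕜 k) :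
    TensorField 𝕜 (k + 1) := fun x I =>
  pd (fun y => T y (Fin.tail I)) (I 0) x -
    ∑ j, ∑ d, christoffel h x d (I 0) (I j.succ) * T x (Function.update (Fin.tail I) j d)

/-- `D_{c_q} … D_{c_1} T_{b_1 … b_k}`, with index order `(c_q, …, c_1, b_1, …, b_k)`. -/
def iterCov (h : Pt 𝕜 → Matrix (Fin 3) (Fin 3) 𝕜) {k : ℕ} (T : TensorField 𝕜 k) :
    (q : ℕ) → TensorField 𝕜 (k + q)
  | 0 => T
  | q + 1 => covDeriv h (iterCov h T q)

/-- `D_{c_p} … D_{c_1} f` for a function `f`, with index order `(c_p, …, c_1)`. -/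
def iterCovFun (h : Pt 𝕜 → Matrix (Fin 3) (Fin 3) 𝕜) (f : Pt 𝕜 → 𝕜) :
    (p : ℕ) → TensorField 𝕜 p
  | 0 => fun x _ => f x
  | p + 1 => covDeriv h (iterCovFun h f p)

/-- The Ricci tensor of `h` (positive on round spheres):
`R_{ab} = ∂_c Γ^c_{ab} - ∂_a Γ^c_{cb} + Γ^c_{cd} Γ^d_{ab} - Γ^c_{ad} Γ^d_{cb}`. -/
def ricci (h : Pt 𝕜 → Matrix (Fin 3) (Fin 3) 𝕜) (x : Pt 𝕜) (a b : Fin 3) : 𝕜 :=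
  ∑ c, (pd (fun y => christoffel h y c a b) c x - pd (fun y => christoffel h y c c b) a x) +
    ∑ c, ∑ d, (christoffel h x c c d * christoffel h x d a b -
      christoffel h x c a d * christoffel h x d c b)

/-- The contraction `u^a v_a = h^{ab} u_a v_b`, with `g` standing for the inverse metric. -/
def ip (g : Matrix (Fin 3) (Fin 3) 𝕜) (u v : Fin 3 → 𝕜) : 𝕜 :=
  ∑ a, ∑ b, g a b * u a * v b

/-- Antisymmetrization `F_{[bc]}`. -/
def alt (F : Fin 3 → Fin 3 → 𝕜) (b c : Fin 3) : 𝕜 := (1 / 2) * (F b c - F c b)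

end Tensor

/-! ### The right-hand sides of the conformal stationary vacuum field equations

At a point: `h`, `g` are the metric and its inverse, `φ Ω R S` the values of the fields,
`dφ dΩ` the gradients and `Hφ` the covariant Hessian of `φ`. -/

section RightHandSides

variable {𝕜 : Type*} [RCLike 𝕜]

/-- Right-hand side of the equation for `Δ φ = h^{ab} D_a D_b φ`. -/
def rhsLaplace (g : Matrix (Fin 3) (Fin 3) 𝕜) (φ Ω R : 𝕜) (dφ dΩ : Fin 3 → 𝕜) : 𝕜 :=
  -φ * ((1 / 2) * R + 5 / (1 + Ω - φ ^ 2) *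
    ((1 / 4) * φ ^ 2 * ip g dΩ dΩ - (1 + Ω) * φ * ip g dΩ dφ + (1 + Ω) ^ 2 * ip g dφ dφ))

/-- Right-hand side of the equation for `D_a D_b Ω`. -/
def rhsHessOmega (h g : Matrix (Fin 3) (Fin 3) 𝕜) (φ Ω R : 𝕜) (S : Fin 3 → Fin 3 → 𝕜)
    (dφ dΩ : Fin 3 → 𝕜) (a b : Fin 3) : 𝕜 :=
  -Ω * S a b - (1 / 3) * (1 + Ω) * h a b * R +
  1 / (1 + Ω - φ ^ 2) *
    ((1 / 2) * (1 + (-1 + Ω) * φ ^ 2) * dΩ a * dΩ b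
      - (1 / 3) * (2 + 3 * Ω) * φ ^ 2 * h a b * ip g dΩ dΩ
      - 2 * Ω ^ 2 * φ * ((1 / 2) * (dΩ a * dφ b + dΩ b * dφ a))
      + (4 / 3) * (1 + Ω) * (2 + 3 * Ω) * φ * h a b * ip g dΩ dφ
      + 2 * Ω ^ 2 * (1 + Ω) * dφ a * dφ b
      - (4 / 3) * (1 + Ω) ^ 2 * (2 + 3 * Ω) * h a b * ip g dφ dφ)

/-- Right-hand side of the equation for `D_a R`. -/
def rhsGradR (g : Matrix (Fin 3) (Fin 3) 𝕜) (φ Ω R : 𝕜) (S : Fin 3 → Fin 3 → 𝕜)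
    (dφ dΩ : Fin 3 → 𝕜) (Hφ : Fin 3 → Fin 3 → 𝕜) (a : Fin 3) : 𝕜 :=
  1 / (1 + Ω - φ ^ 2) *
    (2 * (4 + 7 * Ω) * φ * ip g dΩ (fun b => Hφ b a)
      - 4 * (1 + Ω) * (4 + 7 * Ω) * ip g dφ (fun b => Hφ b a)
      + (3 + (-3 + 7 * Ω) * φ ^ 2) * ip g dΩ (fun b => S b a)
      - 2 * Ω * (4 + 7 * Ω) * φ * ip g dφ (fun b => S b a)
      + (1 / 3) * (4 + 7 * Ω) * φ ^ 2 * R * dΩ a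
      - (2 / 3) * (1 + Ω) * (4 + 7 * Ω) * φ * R * dφ a) +
  1 / (3 * (1 + Ω - φ ^ 2) ^ 2) *
    ((1 / 2) * φ ^ 2 * (-12 + (40 + 21 * Ω) * φ ^ 2) * ip g dΩ dΩ * dΩ a
      - 2 * φ * (-18 * (1 + Ω) + (46 + 61 * Ω + 21 * Ω ^ 2) * φ ^ 2) * ip g dΩ dφ * dΩ a
      + 2 * (1 + Ω) * (-24 * (1 + Ω) + (52 + 61 * Ω + 21 * Ω ^ 2) * φ ^ 2) *
          ip g dφ dφ * dΩ a
      - φ * (12 * (1 + Ω) + (16 + 61 * Ω + 21 * Ω ^ 2) * φ ^ 2) * ip g dΩ dΩ * dφ a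
      + 4 * (1 + Ω) * (6 * (1 + Ω) + (22 + 61 * Ω + 21 * Ω ^ 2) * φ ^ 2) *
          ip g dΩ dφ * dφ a
      - 4 * (1 + Ω) ^ 2 * (28 + 61 * Ω + 21 * Ω ^ 2) * φ * ip g dφ dφ * dφ a)

/-- Right-hand side of the equation for `D_{[c} S_{b]a}`; on the right-hand side the
antisymmetrization is over `[bc]`. -/
def rhsCurlS (h g : Matrix (Fin 3) (Fin 3) 𝕜) (φ Ω R : 𝕜) (S : Fin 3 → Fin 3 → 𝕜)
    (dφ dΩ : Fin 3 → 𝕜) (Hφ : Fin 3 → Fin 3 → 𝕜) (a b c : Fin 3) : 𝕜 :=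
  1 / (1 + Ω - φ ^ 2) *
    (Ω * φ * alt (fun b c => Hφ a b * dΩ c) b c
      - 2 * Ω * (1 + Ω) * alt (fun b c => Hφ a b * dφ c) b c
      - (2 / 3) * (1 + Ω) * φ * alt (fun b c => h a b * ip g (fun d => Hφ c d) dΩ) b c
      + (4 / 3) * (1 + Ω) ^ 2 * alt (fun b c => h a b * ip g (fun d => Hφ c d) dφ) b c
      + (1 / 2) * (1 + (-1 + Ω) * φ ^ 2) * alt (fun b c => S a b * dΩ c) b c
      - Ω ^ 2 * φ * alt (fun b c => S a b * dφ c) b c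
      - (1 / 3) * Ω * φ ^ 2 * alt (fun b c => h a b * ip g (fun d => S c d) dΩ) b c
      + (2 / 3) * Ω * (1 + Ω) * φ * alt (fun b c => h a b * ip g (fun d => S c d) dφ) b c
      + (1 / 18) * (-2 + Ω) * φ ^ 2 * R * alt (fun b c => h a b * dΩ c) b c
      - (1 / 9) * (-2 + Ω) * (1 + Ω) * φ * R * alt (fun b c => h a b * dφ c) b c
      + 2 * φ * dΩ a * alt (fun b c => dΩ b * dφ c) b c
      - 4 * (1 + Ω) * dφ a * alt (fun b c => dΩ b * dφ c) b c) +
  1 / (9 * (1 + Ω - φ ^ 2) ^ 2) *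
    ((1 / 2) * φ ^ 2 * (3 + 2 * (-5 + 3 * Ω) * φ ^ 2) *
          alt (fun b c => h a b * dΩ c) b c * ip g dΩ dΩ
      - φ * (6 * (1 + Ω) + (-13 - 4 * Ω + 6 * Ω ^ 2) * φ ^ 2) *
          alt (fun b c => h a b * dφ c) b c * ip g dΩ dΩ
      - 2 * (-7 - 4 * Ω + 6 * Ω ^ 2) * φ ^ 3 *
          alt (fun b c => h a b * dΩ c) b c * ip g dΩ dφ
      + 4 * (1 + Ω) ^ 2 * (3 + 2 * (-5 + 3 * Ω) * φ ^ 2) *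
          alt (fun b c => h a b * dφ c) b c * ip g dΩ dφ
      + 2 * (1 + Ω) * (-3 * (1 + Ω) + (-4 - 4 * Ω + 6 * Ω ^ 2) * φ ^ 2) *
          alt (fun b c => h a b * dΩ c) b c * ip g dφ dφ
      - 4 * (1 + Ω) ^ 2 * (-7 - 4 * Ω + 6 * Ω ^ 2) * φ *
          alt (fun b c => h a b * dφ c) b c * ip g dφ dφ)

end RightHandSides

/-! ### Solutions and normal frames -/

/-- The unknown fields `h_{ab}, φ, Ω, R, S_{ab}` on a coordinate domain `N` around the
point `i`. -/
structure ConformalFields (𝕜 : Type*) where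
  /-- The (coordinate image of the) manifold. -/
  N : Set (Pt 𝕜)
  /-- The point representing space-like infinity. -/
  i : Pt 𝕜
  /-- The metric. -/
  h : Pt 𝕜 → Matrix (Fin 3) (Fin 3) 𝕜
  /-- The conformal potential. -/
  φ : Pt 𝕜 → 𝕜
  /-- The conformal factor. -/
  Ω : Pt 𝕜 → 𝕜
  /-- The Ricci scalar. -/
  R : Pt 𝕜 → 𝕜
  /-- The trace free part of the Ricci tensor. -/
  S : TensorField 𝕜 2

namespace ConformalFields

variable {𝕜 : Type*} [RCLike 𝕜] (F : ConformalFields 𝕜)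

/-- `D_a φ`. -/
def dφ (x : Pt 𝕜) (a : Fin 3) : 𝕜 := iterCovFun F.h F.φ 1 x ![a]

/-- `D_a Ω`. -/
def dΩ (x : Pt 𝕜) (a : Fin 3) : 𝕜 := iterCovFun F.h F.Ω 1 x ![a]

/-- `D_a R`. -/
def dR (x : Pt 𝕜) (a : Fin 3) : 𝕜 := iterCovFun F.h F.R 1 x ![a]

/-- `D_a D_b φ`. -/
def hessφ (x : Pt 𝕜) (a b : Fin 3) : 𝕜 := iterCovFun F.h F.φ 2 x ![a, b]

/-- `D_a D_b Ω`. -/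
def hessΩ (x : Pt 𝕜) (a b : Fin 3) : 𝕜 := iterCovFun F.h F.Ω 2 x ![a, b]

/-- The components `S_{ab}`. -/
def Sc (x : Pt 𝕜) (a b : Fin 3) : 𝕜 := F.S x ![a, b]

/-- `D_c S_{ab}`. -/
def dS (x : Pt 𝕜) (c a b : Fin 3) : 𝕜 := covDeriv F.h F.S x ![c, a, b]

/-- `F` is a solution of the conformal stationary vacuum field equations on `N`, with the
conditions at `i`. -/
structure IsSolution : Prop where
  isOpen_N : IsOpen F.N
  i_mem : F.i ∈ F.N
  smooth_h : ∀ a b, ContDiffOn 𝕜 ∞ (fun x => F.h x a b) F.N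
  smooth_φ : ContDiffOn 𝕜 ∞ F.φ F.N
  smooth_Ω : ContDiffOn 𝕜 ∞ F.Ω F.N
  smooth_R : ContDiffOn 𝕜 ∞ F.R F.N
  smooth_S : ∀ I, ContDiffOn 𝕜 ∞ (fun x => F.S x I) F.N
  metric_symm : ∀ x ∈ F.N, (F.h x).IsSymm
  metric_nondeg : ∀ x ∈ F.N, (F.h x).det ≠ 0
  S_symm : ∀ x ∈ F.N, ∀ a b, F.Sc x a b = F.Sc x b a
  S_tracefree : ∀ x ∈ F.N, ∑ a, ∑ b, (F.h x)⁻¹ a b * F.Sc x a b = 0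
  /-- The denominators in the equations do not vanish. -/
  denom_ne_zero : ∀ x ∈ F.N, 1 + F.Ω x - F.φ x ^ 2 ≠ 0
  eq_ricci : ∀ x ∈ F.N, ∀ a b,
    ricci F.h x a b = F.Sc x a b + (1 / 3) * F.h x a b * F.R x
  eq_laplace : ∀ x ∈ F.N,
    ∑ a, ∑ b, (F.h x)⁻¹ a b * F.hessφ x a b =
      rhsLaplace (F.h x)⁻¹ (F.φ x) (F.Ω x) (F.R x) (F.dφ x) (F.dΩ x)
  eq_hessΩ : ∀ x ∈ F.N, ∀ a b,
    F.hessΩ x a b =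
      rhsHessOmega (F.h x) (F.h x)⁻¹ (F.φ x) (F.Ω x) (F.R x) (F.Sc x) (F.dφ x) (F.dΩ x) a b
  eq_gradR : ∀ x ∈ F.N, ∀ a,
    F.dR x a =
      rhsGradR (F.h x)⁻¹ (F.φ x) (F.Ω x) (F.R x) (F.Sc x) (F.dφ x) (F.dΩ x) (F.hessφ x) a
  eq_curlS : ∀ x ∈ F.N, ∀ a b c,
    alt (fun c b => F.dS x c b a) c b =
      rhsCurlS (F.h x) (F.h x)⁻¹ (F.φ x) (F.Ω x) (F.R x) (F.Sc x) (F.dφ x) (F.dΩ x)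
        (F.hessφ x) a b c
  φ_at_i : F.φ F.i = 0
  Ω_at_i : F.Ω F.i = 0
  dΩ_at_i : ∀ a, F.dΩ F.i a = 0
  hessΩ_at_i : ∀ a b, F.hessΩ F.i a b = 2 * F.h F.i a b
  R_at_i : F.R F.i = -(6 + 8 * ip (F.h F.i)⁻¹ (F.dφ F.i) (F.dφ F.i))

/-- `γ` is a geodesic of `F.h` in `F.N` with parameter domain `J`. -/
def IsGeodesicOn (γ : 𝕜 → Pt 𝕜) (J : Set 𝕜) : Prop :=
  Set.MapsTo γ J F.N ∧ ContDiffOn 𝕜 ∞ γ J ∧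
  ∀ t ∈ J, ∀ a,
    deriv (fun τ => deriv γ τ a) t +
      ∑ b, ∑ c, christoffel F.h (γ t) a b c * deriv γ t b * deriv γ t c = 0

/-- The frame field `c` (with `c x a b = c^b_a(x)`, the `b`-th coordinate component of the
`a`-th frame vector) is a normal frame centered at `i`: orthonormal, `h(c_a, c_b) = s δ_{ab}`
with the sign `s`, and parallelly transported along the geodesics through `i`. -/
structure IsNormalFrame (s : ℤˣ) (c : Pt 𝕜 → Fin 3 → Fin 3 → 𝕜) : Prop where
  smooth : ContDiffOn 𝕜 ∞ c F.N
  orthonormal : ∀ x ∈ F.N, ∀ a b,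
    ∑ d, ∑ e, F.h x d e * c x a d * c x b e = if a = b then ((s : ℤ) : 𝕜) else 0
  parallel : ∀ (J : Set 𝕜) (γ : 𝕜 → Pt 𝕜), IsOpen J → IsPreconnected J → 0 ∈ J →
    γ 0 = F.i → F.IsGeodesicOn γ J →
    ∀ t ∈ J, ∀ a b,
      deriv (fun τ => c (γ τ) a b) t +
        ∑ d, ∑ e, christoffel F.h (γ t) b d e * deriv γ t d * c (γ t) a e = 0

end ConformalFields

/-! ### Space-spinors -/

/-- The components `T_{A_1 B_1 … A_p B_p}` of a spinor with `p` index pairs; the index at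
position `(j, 0)` is the `A` and that at `(j, 1)` the `B` of the `j`-th pair. -/
abbrev Spinor (p : ℕ) := (Fin p × Fin 2 → Fin 2) → ℂ

/-- The van der Waerden symbols `α^a_{AB}`. -/
def vdW : Fin 3 → Matrix (Fin 2) (Fin 2) ℂ :=
  ![((1 / Real.sqrt 2 : ℝ) : ℂ) • !![-1, 0; 0, 1],
    ((1 / Real.sqrt 2 : ℝ) : ℂ) • !![Complex.I, 0; 0, Complex.I],
    ((1 / Real.sqrt 2 : ℝ) : ℂ) • !![0, 1; 1, 0]]

/-- The inclusion of the ground field `𝕜 = ℝ, ℂ` in `ℂ`. -/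
def toC {𝕜 : Type*} [RCLike 𝕜] (z : 𝕜) : ℂ := ⟨RCLike.re z, RCLike.im z⟩

/-- Frame components `T_{𝐚_1 … 𝐚_p}` at a point of a tensor with coordinate components `T`. -/
def frameComp {𝕜 : Type*} [RCLike 𝕜] {p : ℕ} (c : Fin 3 → Fin 3 → 𝕜)
    (T : (Fin p → Fin 3) → 𝕜) (I : Fin p → Fin 3) : 𝕜 :=
  ∑ K : Fin p → Fin 3, (∏ j, c (I j) (K j)) * T K

/-- The space-spinor `T_{𝐚_1 … 𝐚_p} α^{a_1}_{A_1 B_1} … α^{a_p}_{A_p B_p}` of a tensor given in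
the frame. -/
def toSpinor {𝕜 : Type*} [RCLike 𝕜] {p : ℕ} (T : (Fin p → Fin 3) → 𝕜) : Spinor p := fun A =>
  ∑ I : Fin p → Fin 3, toC (T I) * ∏ j, vdW (I j) (A (j, 0)) (A (j, 1))

/-- Symmetrization over all the spinor indices. -/
def symmetrize {p : ℕ} (T : Spinor p) : Spinor p := fun A =>
  (1 / (Nat.factorial (2 * p) : ℂ)) * ∑ σ : Equiv.Perm (Fin p × Fin 2), T (A ∘ σ)

/-- Total symmetry in all the spinor indices. -/
def IsTotallySymmetric {p : ℕ} (T : Spinor p) : Prop :=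
  ∀ (σ : Equiv.Perm (Fin p × Fin 2)) (A : Fin p × Fin 2 → Fin 2), T (A ∘ σ) = T A

/-- The matrix `τ_A^{A'}`: with `ε_{01} = 1` and index lowering
`ι_B = ι^A ε_{AB}` one gets `τ_0^1 = -1`, `τ_1^0 = 1`. -/
def tau : Matrix (Fin 2) (Fin 2) ℂ := !![0, -1; 1, 0]

/-- The conjugation `T⁺_{A…H} = τ_A^{A'} … τ_H^{H'} \bar T_{A'…H'}`. -/
def plusConj {p : ℕ} (T : Spinor p) : Spinor p := fun A =>
  ∑ A' : Fin p × Fin 2 → Fin 2, (∏ e, tau (A e) (A' e)) * (starRingEnd ℂ) (T A')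

/-- The reality condition `T_{A_1 B_1 … A_p B_p} = (-1)^p T⁺_{A_1 B_1 … A_p B_p}`. -/
def IsRealSpinor {p : ℕ} (T : Spinor p) : Prop :=
  ∀ A, T A = (-1) ^ p * plusConj T A

/-! ### Normal expansion coefficients and null data -/

namespace ConformalFields

variable {𝕜 : Type*} [RCLike 𝕜] (F : ConformalFields 𝕜) (c : Pt 𝕜 → Fin 3 → Fin 3 → 𝕜)

/-- The coefficient `D_{A_p B_p} … D_{A_1 B_1} f (i)` of the normal expansion of a function. -/
def funCoeff (f : Pt 𝕜 → 𝕜) (p : ℕ) : Spinor p :=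
  toSpinor (frameComp (c F.i) (iterCovFun F.h f p F.i))

/-- The coefficient `D_{A_p B_p} … D_{A_1 B_1} S_{ABCD}(i)` of the normal expansion of `S`. -/
def SCoeff (p : ℕ) : Spinor (2 + p) :=
  toSpinor (frameComp (c F.i) (iterCov F.h F.S p F.i))

/-- The null data in the frame `c` are `ψ` (with `p ≥ 1` index pairs) and `Ψ` (with `p ≥ 2`
index pairs). -/
def HasNullData (ψ Ψ : (p : ℕ) → Spinor p) : Prop :=
  (∀ p, 1 ≤ p → ψ p = symmetrize (F.funCoeff c F.φ p)) ∧
  (∀ q, Ψ (2 + q) = symmetrize (F.SCoeff c q))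

end ConformalFields

end ConfStat

end

noncomputable section

namespace ConfStat

/-! ### Space-spinor algebra -/

section SpinorAlgebra

/-! The argument runs on the bundle of linear frames. There a tensor field becomes a family of
scalar functions (its frame components, `comp`), and the covariant derivative becomes
differentiation along the standard horizontal vector fields (`horDeriv_comp`). Two of these fields
commute up to a vertical field built from the curvature, which gives the Ricci identity
(`horDeriv_comm_comp`).

Two solutions are compared at their distinguished frames along a ring endomorphism `θ` of the ground
field. `Agr k f` says that all horizontal derivatives of `f` of order less than `k` correspond under
`θ`. This relation is stable under sums, products and inverses, so it passes through the right-hand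
sides of the field equations. Uniqueness is the case `θ = id`. Reality is the case of one solution
compared with itself under conjugation: the reality condition on spinors says that the frame
components are real, and real null data are null data invariant under conjugation.

The heart is an induction on the order (`SolutionPair.good`). Suppose that `φ`, `Ω` agree to order
`n` and `R`, `S` to order `n - 1`. Then the Ricci tensor agrees to order `n - 1`, and so does the
full curvature, since the dimension is three. Hence the discrepancy of the `n`-th derivatives of `φ`
at the frame is a symmetric tensor, because reordering derivatives produces only terms that already
agree. It is also trace-free, because the Laplace equation expresses traces through lower order. A
symmetric trace-free tensor has a totally symmetric spinor, so it is detected by the null data and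
must vanish (`matches_of_symmetrize`). The same works for `S`, where the curl equation handles the
exchange of a derivative index with a tensor index. `Ω` and `R` carry no free data: their Hessian
and gradient equations, with the conditions at `i`, determine them. -/

lemma sum_update_swap {ι M : Type*} [Fintype ι] [DecidableEq ι] [AddCommMonoid M] (j : ι)
    (G : (ι → Fin 3) → Fin 3 → M) :
    ∑ I : ι → Fin 3, ∑ s, G (Function.update I j s) (I j) = ∑ I : ι → Fin 3, ∑ s, G I s := by
  rw [← Fintype.sum_prod_type' (f := fun (I : ι → Fin 3) s => G (Function.update I j s) (I j)),
    ← Fintype.sum_prod_type' (f := fun (I : ι → Fin 3) s => G I s)]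
  refine Finset.sum_nbij' (fun q => (Function.update q.1 j q.2, q.1 j))
    (fun q => (Function.update q.1 j q.2, q.1 j)) ?_ ?_ ?_ ?_ ?_ <;> simp

/-- Overwriting the slots `j` and `k` by all values and then summing over `I` counts every term nine
times. Two full sums can therefore be compared with all other slots frozen. -/
lemma sum_congr_of_update {ι : Type*} [Fintype ι] [DecidableEq ι] (j k : ι)
    (F G : (ι → Fin 3) → ℂ)
    (hFG : ∀ I : ι → Fin 3, ∑ s, ∑ t, F (Function.update (Function.update I j s) k t) =
      ∑ s, ∑ t, G (Function.update (Function.update I j s) k t)) :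
    ∑ I, F I = ∑ I, G I := by
  have aux : ∀ F : (ι → Fin 3) → ℂ,
      ∑ I, ∑ s, ∑ t, F (Function.update (Function.update I j s) k t) = 9 * ∑ I, F I := by
    intro F
    rw [sum_update_swap j (fun I _ => ∑ t, F (Function.update I k t))]
    simp only [Finset.sum_const, Finset.card_univ, Fintype.card_fin, nsmul_eq_mul]
    rw [← Finset.mul_sum, sum_update_swap k (fun I _ => F I)]
    simp only [Finset.sum_const, Finset.card_univ, Fintype.card_fin, nsmul_eq_mul]
    rw [← Finset.mul_sum]
    push_cast
    ring
  have h := Finset.sum_congr (rfl : (Finset.univ : Finset (ι → Fin 3)) = _)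
    (fun I _ => hFG I)
  rw [aux, aux] at h
  exact mul_left_cancel₀ (by norm_num) h

lemma vdW_symm (a : Fin 3) (A B : Fin 2) : vdW a A B = vdW a B A := by
  fin_cases a <;> fin_cases A <;> fin_cases B <;> simp [vdW]

/-- A symmetric trace-free tensor of rank two has a totally symmetric spinor. -/
lemma vdW_exchange (M : Fin 3 → Fin 3 → ℂ) (hs : ∀ a b, M a b = M b a)
    (ht : ∑ a, M a a = 0) (p q r u : Fin 2) :
    ∑ a, ∑ b, M a b * (vdW a p q * vdW b r u) = ∑ a, ∑ b, M a b * (vdW a r q * vdW b p u) := by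
  have h01 := hs 1 0
  have h02 := hs 2 0
  have h12 := hs 2 1
  simp only [Fin.sum_univ_three] at ht ⊢
  rw [h01, h02, h12]
  have ht' : M 2 2 = - M 0 0 - M 1 1 := by linear_combination ht
  rw [ht']
  have hI := Complex.I_mul_I
  -- The difference of the two sides is antisymmetric in `p`, `r`, hence a multiple of the
  -- contraction of these two indices. The part of that contraction symmetric in `a`, `b` is
  -- proportional to the Kronecker delta, so only the trace of `M` could survive. This is verified
  -- here component by component.
  fin_cases p <;> fin_cases q <;> fin_cases r <;> fin_cases u <;>
    simp [vdW] <;> grind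

lemma vdW_orthonormal (a b : Fin 3) :
    ∑ A, ∑ B, vdW a A B * (starRingEnd ℂ) (vdW b A B) = if a = b then 1 else 0 := by
  have h2 : ((1 / Real.sqrt 2 : ℝ) : ℂ) * ((1 / Real.sqrt 2 : ℝ) : ℂ) = 1 / 2 := by
    rw [← Complex.ofReal_mul, div_mul_div_comm, Real.mul_self_sqrt (by norm_num)]
    norm_num
  have hc := Complex.conj_ofReal (1 / Real.sqrt 2)
  have hI := Complex.I_mul_I
  generalize hw : ((1 / Real.sqrt 2 : ℝ) : ℂ) = w at h2 hc
  fin_cases a <;> fin_cases b <;>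
    simp only [vdW, hw, Fin.sum_univ_two] <;> simp [hc] <;> grind

/-- Each index pair contributes one minus sign under the spinor conjugation; this is the origin of
the factor `(-1) ^ p` in the reality condition. -/
lemma tau_vdW (a : Fin 3) (A B : Fin 2) :
    ∑ A', ∑ B', tau A A' * tau B B' * (starRingEnd ℂ) (vdW a A' B') = - vdW a A B := by
  have hc := Complex.conj_ofReal (1 / Real.sqrt 2)
  generalize hw : ((1 / Real.sqrt 2 : ℝ) : ℂ) = w at hc
  fin_cases a <;> fin_cases A <;> fin_cases B <;>
    simp only [vdW, hw, Fin.sum_univ_two] <;> simp [tau, hc]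

lemma sum_prod_pairs {p : ℕ} (g : Fin p → Fin 2 → Fin 2 → ℂ) :
    ∑ A : Fin p × Fin 2 → Fin 2, ∏ j, g j (A (j, 0)) (A (j, 1)) =
      ∏ j, ∑ B, ∑ C, g j B C := by
  have h1 : ∀ j, ∑ B, ∑ C, g j B C = ∑ D : Fin 2 → Fin 2, g j (D 0) (D 1) := by
    intro j
    rw [← (finTwoArrowEquiv (Fin 2)).symm.sum_comp, Fintype.sum_prod_type]
    simp
  simp only [h1]
  rw [Finset.prod_univ_sum, Fintype.piFinset_univ,
    ← (Equiv.curry (Fin p) (Fin 2) (Fin 2)).sum_comp]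
  rfl

variable {𝕜 : Type*} [RCLike 𝕜]

/-- `toC` as a ring homomorphism. -/
def toCHom : 𝕜 →+* ℂ where
  toFun := toC
  map_one' := by apply Complex.ext <;> simp [toC]
  map_mul' x y := by apply Complex.ext <;> simp [toC, RCLike.mul_re, RCLike.mul_im]
  map_zero' := by apply Complex.ext <;> simp [toC]
  map_add' x y := by apply Complex.ext <;> simp [toC]

lemma toC_eq_toCHom (z : 𝕜) : toC z = toCHom z := rfl

lemma toC_star (z : 𝕜) : toC ((starRingEnd 𝕜) z) = (starRingEnd ℂ) (toC z) := by
  apply Complex.ext <;> simp [toC]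

lemma toC_injective : Function.Injective (toC : 𝕜 → ℂ) := (toCHom (𝕜 := 𝕜)).injective

lemma toSpinor_sub {p : ℕ} (T T' : (Fin p → Fin 3) → 𝕜) :
    toSpinor (fun I => T I - T' I) = fun A => toSpinor T A - toSpinor T' A := by
  funext A
  simp only [toSpinor, toC_eq_toCHom, map_sub, sub_mul, Finset.sum_sub_distrib]

lemma symmetrize_sub {p : ℕ} (T T' : Spinor p) :
    symmetrize (fun A => T A - T' A) = fun A => symmetrize T A - symmetrize T' A := by
  funext A
  simp only [symmetrize, Finset.sum_sub_distrib, mul_sub]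

lemma symmetrize_eq_self {p : ℕ} {T : Spinor p} (h : IsTotallySymmetric T) :
    symmetrize T = T := by
  funext A
  have hc : Fintype.card (Equiv.Perm (Fin p × Fin 2)) = Nat.factorial (2 * p) := by
    rw [Fintype.card_perm]
    simp [mul_comm]
  simp only [symmetrize, h _ A, Finset.sum_const, Finset.card_univ, hc, nsmul_eq_mul]
  rw [← mul_assoc, one_div, inv_mul_cancel₀ (by exact_mod_cast Nat.factorial_ne_zero _), one_mul]

/-- The symbols are orthonormal for the Hermitian pairing, so contracting with their conjugates
recovers each frame component. -/
lemma toSpinor_eq_zero {p : ℕ} {X : (Fin p → Fin 3) → 𝕜} (h : toSpinor X = 0) : X = 0 := by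
  funext J
  apply toC_injective
  have h1 : ∑ A, toSpinor X A * ∏ j, (starRingEnd ℂ) (vdW (J j) (A (j, 0)) (A (j, 1))) =
      toC (X J) := by
    simp only [toSpinor, Finset.sum_mul, mul_assoc, ← Finset.prod_mul_distrib]
    rw [Finset.sum_comm]
    simp only [← Finset.mul_sum]
    have h2 : ∀ I : Fin p → Fin 3, ∑ A : Fin p × Fin 2 → Fin 2,
        ∏ j, vdW (I j) (A (j, 0)) (A (j, 1)) *
          (starRingEnd ℂ) (vdW (J j) (A (j, 0)) (A (j, 1))) =
        ∏ j, if I j = J j then (1 : ℂ) else 0 := fun I => by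
      rw [sum_prod_pairs (fun j B C => vdW (I j) B C * (starRingEnd ℂ) (vdW (J j) B C))]
      simp only [vdW_orthonormal]
    simp only [h2]
    rw [Finset.sum_eq_single J]
    · simp
    · intro I _ hI
      obtain ⟨j, hj⟩ := Function.ne_iff.1 hI
      rw [Finset.prod_eq_zero (Finset.mem_univ j) (by simp [hj]), mul_zero]
    · simp
  rw [← h1, h]
  simp [toC_eq_toCHom]

/-- The signs from `tau_vdW` cancel `(-1) ^ p`. The reality condition thus amounts to ordinary
conjugation acting trivially on frame components. -/
lemma plusConj_toSpinor {p : ℕ} (T : (Fin p → Fin 3) → 𝕜) (A : Fin p × Fin 2 → Fin 2) :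
    (-1) ^ p * plusConj (toSpinor T) A = toSpinor (fun I => (starRingEnd 𝕜) (T I)) A := by
  simp only [plusConj, toSpinor, map_sum, map_mul, map_prod, Finset.mul_sum, toC_star]
  rw [Finset.sum_comm]
  refine Finset.sum_congr rfl fun I _ => ?_
  have h := sum_prod_pairs (fun j B C => tau (A (j, 0)) B * tau (A (j, 1)) C *
    (starRingEnd ℂ) (vdW (I j) B C))
  simp only [tau_vdW] at h
  rw [Finset.prod_neg] at h
  simp only [Finset.card_univ, Fintype.card_fin] at h
  have h3 : ∏ j, vdW (I j) (A (j, 0)) (A (j, 1)) =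
      (-1) ^ p * ((-1) ^ p * ∏ j, vdW (I j) (A (j, 0)) (A (j, 1))) := by
    rw [← mul_assoc, ← mul_pow]; simp
  rw [h3, ← h]
  simp only [Finset.mul_sum]
  refine Finset.sum_congr rfl fun A' _ => ?_
  rw [Fintype.prod_prod_type]
  simp only [Fin.prod_univ_two, Finset.prod_mul_distrib]
  ring

lemma plusConj_symmetrize {p : ℕ} (T : Spinor p) :
    plusConj (symmetrize T) = symmetrize (plusConj T) := by
  funext A
  simp only [plusConj, symmetrize, map_mul, map_sum, Finset.mul_sum]
  rw [Finset.sum_comm]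
  refine Finset.sum_congr rfl fun σ _ => ?_
  rw [← (Equiv.arrowCongr σ (Equiv.refl (Fin 2))).sum_comp]
  refine Finset.sum_congr rfl fun A' _ => ?_
  have h1 : ∏ e, tau (A e) ((Equiv.arrowCongr σ (Equiv.refl (Fin 2))) A' e) =
      ∏ e, tau ((A ∘ σ) e) (A' e) := by
    rw [← Equiv.prod_comp σ]
    simp
  have h2 : ((Equiv.arrowCongr σ (Equiv.refl (Fin 2))) A') ∘ σ = A' := by
    funext e; simp
  rw [h1, h2]
  simp
  ring

lemma isRealSpinor_toSpinor {p : ℕ} {T : (Fin p → Fin 3) → 𝕜}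
    (h : ∀ I, (starRingEnd 𝕜) (T I) = T I) : IsRealSpinor (toSpinor T) := by
  intro A
  rw [plusConj_toSpinor]
  simp only [h]

/-- The form in which real null data enter the comparison: conjugating the components does not
change the null data. -/
lemma symmetrize_star_of_isRealSpinor {p : ℕ} {T : (Fin p → Fin 3) → 𝕜}
    (h : IsRealSpinor (symmetrize (toSpinor T))) :
    symmetrize (toSpinor (fun I => (starRingEnd 𝕜) (T I))) = symmetrize (toSpinor T) := by
  funext A
  rw [h A, plusConj_symmetrize]
  simp only [symmetrize, ← plusConj_toSpinor, Finset.mul_sum]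
  exact Finset.sum_congr rfl fun σ _ => by ring

/-- Within one index pair the symmetry of the symbols suffices. For indices from different pairs,
all other slots are frozen and `vdW_exchange` applies to the symmetric trace-free rank-two tensor in
the two remaining slots. -/
lemma toSpinor_swap {p : ℕ} {X : (Fin p → Fin 3) → 𝕜}
    (hsym : ∀ (σ : Equiv.Perm (Fin p)) I, X (I ∘ σ) = X I)
    (htr : ∀ (j k : Fin p), j ≠ k → ∀ I,
      ∑ a, X (Function.update (Function.update I j a) k a) = 0)
    (x y : Fin p × Fin 2) (hxy : x ≠ y) (A : Fin p × Fin 2 → Fin 2) :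
    toSpinor X (A ∘ Equiv.swap x y) = toSpinor X A := by
  obtain ⟨j, a⟩ := x
  obtain ⟨k, b⟩ := y
  by_cases hjk : j = k
  · subst hjk
    refine Finset.sum_congr rfl fun I _ => ?_
    congr 1
    refine Finset.prod_congr rfl fun l _ => ?_
    by_cases hl : l = j
    · subst hl
      fin_cases a <;> fin_cases b <;> simp at hxy ⊢
      · rw [vdW_symm]
      · rw [vdW_symm]
    · simp only [Function.comp]
      rw [Equiv.swap_apply_of_ne_of_ne (by simp [hl]) (by simp [hl]),
        Equiv.swap_apply_of_ne_of_ne (by simp [hl]) (by simp [hl])]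
  · refine sum_congr_of_update j k _ _ fun I => ?_
    set M : Fin 3 → Fin 3 → ℂ := fun s t =>
      toC (X (Function.update (Function.update I j s) k t)) with hM
    have hMs : ∀ s t, M s t = M t s := by
      intro s t
      simp only [hM]
      congr 1
      rw [← hsym (Equiv.swap j k)]
      congr 1
      funext l
      by_cases h1 : l = j
      · subst h1; simp [hjk]
      · by_cases h2 : l = k
        · subst h2; simp [hjk]
        · simp [Equiv.swap_apply_of_ne_of_ne h1 h2, h1, h2]
    have hMt : ∑ s, M s s = 0 := by
      simp only [hM, toC_eq_toCHom, ← map_sum, htr j k hjk I, map_zero]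
    have hsplit : ∀ (B : Fin p × Fin 2 → Fin 2) (s t : Fin 3),
        ∏ l, vdW (Function.update (Function.update I j s) k t l) (B (l, 0)) (B (l, 1)) =
          vdW s (B (j, 0)) (B (j, 1)) * vdW t (B (k, 0)) (B (k, 1)) *
            ∏ l ∈ (Finset.univ.erase j).erase k, vdW (I l) (B (l, 0)) (B (l, 1)) := by
      intro B s t
      rw [← Finset.mul_prod_erase _ _ (Finset.mem_univ j),
        ← Finset.mul_prod_erase (Finset.univ.erase j) _
          (Finset.mem_erase.2 ⟨Ne.symm hjk, Finset.mem_univ k⟩), ← mul_assoc]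
      congr 1
      · simp [hjk]
      · refine Finset.prod_congr rfl fun l hl => ?_
        simp only [Finset.mem_erase] at hl
        simp [hl.1, hl.2.1]
    have hrest : ∏ l ∈ (Finset.univ.erase j).erase k, vdW (I l)
          ((A ∘ Equiv.swap (j, a) (k, b)) (l, 0)) ((A ∘ Equiv.swap (j, a) (k, b)) (l, 1)) =
        ∏ l ∈ (Finset.univ.erase j).erase k, vdW (I l) (A (l, 0)) (A (l, 1)) := by
      refine Finset.prod_congr rfl fun l hl => ?_
      simp only [Finset.mem_erase] at hl
      simp only [Function.comp]
      rw [Equiv.swap_apply_of_ne_of_ne (by simp [hl]) (by simp [hl]),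
        Equiv.swap_apply_of_ne_of_ne (by simp [hl]) (by simp [hl])]
    simp only [hsplit, hrest]
    simp only [← mul_assoc, ← Finset.sum_mul]
    congr 1
    have hx := vdW_exchange M hMs hMt
    have e1 : ∀ (A' : Fin 2), A' = 0 ∨ A' = 1 := by decide
    change ∑ s, ∑ t, M s t * _ * _ = ∑ s, ∑ t, M s t * _ * _
    have hkj : ¬ k = j := fun h => hjk h.symm
    have hsw1 : (A ∘ Equiv.swap (j, a) (k, b)) (j, a) = A (k, b) := by simp
    have hsw2 : (A ∘ Equiv.swap (j, a) (k, b)) (k, b) = A (j, a) := by simp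
    have hsw3 : ∀ a', a' ≠ a → (A ∘ Equiv.swap (j, a) (k, b)) (j, a') = A (j, a') := by
      intro a' ha
      simp only [Function.comp]
      rw [Equiv.swap_apply_of_ne_of_ne (by simp [ha]) (by simp [hjk])]
    have hsw4 : ∀ b', b' ≠ b → (A ∘ Equiv.swap (j, a) (k, b)) (k, b') = A (k, b') := by
      intro b' hb
      simp only [Function.comp]
      rw [Equiv.swap_apply_of_ne_of_ne (by simp [hkj]) (by simp [hb])]
    generalize (A ∘ Equiv.swap (j, a) (k, b)) = A' at *
    simp only [mul_assoc]
    -- `vdW_exchange` swaps the first indices of two pairs; the other positions reduce to it by the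
    -- symmetry of the symbols.
    rcases e1 a with rfl | rfl <;> rcases e1 b with rfl | rfl
    · rw [hsw1, hsw2, hsw3 1 (by decide), hsw4 1 (by decide)]
      exact hx _ _ _ _
    · rw [hsw1, hsw2, hsw3 1 (by decide), hsw4 0 (by decide)]
      simp only [fun s => vdW_symm s (A (k, 0))]
      exact hx _ _ _ _
    · rw [hsw1, hsw2, hsw3 0 (by decide), hsw4 1 (by decide)]
      simp only [fun s => vdW_symm s (A (j, 0))]
      exact hx _ _ _ _
    · rw [hsw1, hsw2, hsw3 0 (by decide), hsw4 0 (by decide)]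
      simp only [fun s => vdW_symm s (A (j, 0)), fun s => vdW_symm s (A (k, 0))]
      exact hx _ _ _ _

/-- A symmetric trace-free tensor vanishes if the symmetrized spinor does. -/
lemma eq_zero_of_symmetrize_toSpinor {p : ℕ} {X : (Fin p → Fin 3) → 𝕜}
    (hsym : ∀ (σ : Equiv.Perm (Fin p)) I, X (I ∘ σ) = X I)
    (htr : ∀ (j k : Fin p), j ≠ k → ∀ I,
      ∑ a, X (Function.update (Function.update I j a) k a) = 0)
    (h0 : symmetrize (toSpinor X) = 0) : X = 0 := by
  apply toSpinor_eq_zero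
  rw [← h0, symmetrize_eq_self]
  intro σ
  induction σ using Equiv.Perm.swap_induction_on with
  | one => intro A; rfl
  | swap_mul f x y hxy ih =>
    intro A
    have := toSpinor_swap hsym htr x y hxy A
    rw [← this]
    exact ih (A ∘ Equiv.swap x y)

end SpinorAlgebra

/-! ### Calculus on the frame bundle -/

section FrameBundle

variable {𝕜 : Type*} [RCLike 𝕜]

/-- Points of the (linear) frame bundle: a point and three vectors. -/
abbrev Fr (𝕜 : Type*) := Pt 𝕜 × (Fin 3 → Fin 3 → 𝕜)

/-- The standard horizontal vector fields on the frame bundle. -/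
def hor (h : Pt 𝕜 → Matrix (Fin 3) (Fin 3) 𝕜) (a : Fin 3) (p : Fr 𝕜) : Fr 𝕜 :=
  (p.2 a, fun b n => - ∑ m, ∑ l, christoffel h p.1 n m l * p.2 a m * p.2 b l)

/-- The derivative along a standard horizontal vector field. -/
def horDeriv (h : Pt 𝕜 → Matrix (Fin 3) (Fin 3) 𝕜) (a : Fin 3) (f : Fr 𝕜 → 𝕜) (p : Fr 𝕜) : 𝕜 :=
  fderiv 𝕜 f p (hor h a p)

/-- The frame components of a tensor field, as functions on the frame bundle. -/
def comp {k : ℕ} (T : TensorField 𝕜 k) (I : Fin k → Fin 3) (p : Fr 𝕜) : 𝕜 :=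
  frameComp p.2 (T p.1) I

/-- The frames over `N`. -/
def frameDomain (N : Set (Pt 𝕜)) : Set (Fr 𝕜) := {p | p.1 ∈ N ∧ (Matrix.of p.2).det ≠ 0}

lemma isOpen_frameDomain {N : Set (Pt 𝕜)} (hN : IsOpen N) : IsOpen (frameDomain N) := by
  refine (hN.preimage continuous_fst).inter ?_
  refine isOpen_ne.preimage (f := fun p : Fr 𝕜 => (Matrix.of p.2).det) ?_
  exact Continuous.matrix_det continuous_snd

/-- Smooth tensor fields on `N`. -/
def SmoothTensor {k : ℕ} (N : Set (Pt 𝕜)) (T : TensorField 𝕜 k) : Prop :=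
  ∀ I, ContDiffOn 𝕜 ∞ (fun x => T x I) N

lemma contDiff_frame_coord (b n : Fin 3) : ContDiff 𝕜 ∞ (fun p : Fr 𝕜 => p.2 b n) :=
  contDiff_pi.1 (contDiff_pi.1 contDiff_snd b) n

lemma contDiffOn_comp {k : ℕ} {N : Set (Pt 𝕜)} {T : TensorField 𝕜 k} (hT : SmoothTensor N T)
    (I : Fin k → Fin 3) : ContDiffOn 𝕜 ∞ (comp T I) (frameDomain N) := by
  unfold comp frameComp
  refine ContDiffOn.sum fun K _ => ContDiffOn.mul ?_ ?_
  · exact contDiffOn_prod fun j _ => (contDiff_frame_coord _ _).contDiffOn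
  · exact (hT K).comp contDiff_fst.contDiffOn fun p hp => hp.1

lemma contDiffOn_pd {N : Set (Pt 𝕜)} (hN : IsOpen N) {f : Pt 𝕜 → 𝕜} (hf : ContDiffOn 𝕜 ∞ f N)
    (a : Fin 3) : ContDiffOn 𝕜 ∞ (fun x => pd f a x) N :=
  (hf.fderiv_of_isOpen hN (by simp)).clm_apply contDiffOn_const

lemma contDiffOn_det {E : Type*} [NormedAddCommGroup E] [NormedSpace 𝕜 E] {N : Set E}
    {m : ℕ} {h : E → Matrix (Fin m) (Fin m) 𝕜}
    (hh : ∀ a b, ContDiffOn 𝕜 ∞ (fun x => h x a b) N) :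
    ContDiffOn 𝕜 ∞ (fun x => (h x).det) N := by
  simp only [Matrix.det_apply']
  exact ContDiffOn.sum fun σ _ => contDiffOn_const.mul (contDiffOn_prod fun j _ => hh _ _)

lemma contDiffOn_inv {E : Type*} [NormedAddCommGroup E] [NormedSpace 𝕜 E] {N : Set E}
    {m : ℕ} {h : E → Matrix (Fin m) (Fin m) 𝕜}
    (hh : ∀ a b, ContDiffOn 𝕜 ∞ (fun x => h x a b) N) (hd : ∀ x ∈ N, (h x).det ≠ 0)
    (a b : Fin m) : ContDiffOn 𝕜 ∞ (fun x => (h x)⁻¹ a b) N := by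
  simp only [Matrix.inv_def, Matrix.smul_apply, smul_eq_mul, Ring.inverse_eq_inv',
    Matrix.adjugate_apply]
  refine ((contDiffOn_det hh).inv hd).mul (contDiffOn_det fun i j => ?_)
  by_cases hi : i = b
  · subst hi; simp only [Matrix.updateRow_self]; exact contDiffOn_const
  · simp only [Matrix.updateRow_ne hi]; exact hh i j

/-- A smooth symmetric non-degenerate metric on an open set. -/
structure IsMetricOn (N : Set (Pt 𝕜)) (h : Pt 𝕜 → Matrix (Fin 3) (Fin 3) 𝕜) : Prop where
  isOpen : IsOpen N
  smooth : ∀ a b, ContDiffOn 𝕜 ∞ (fun x => h x a b) N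
  symm : ∀ x ∈ N, (h x).IsSymm
  nondeg : ∀ x ∈ N, (h x).det ≠ 0

variable {N : Set (Pt 𝕜)} {h : Pt 𝕜 → Matrix (Fin 3) (Fin 3) 𝕜}

lemma IsMetricOn.contDiffOn_christoffel (hm : IsMetricOn N h) (d a b : Fin 3) :
    ContDiffOn 𝕜 ∞ (fun x => christoffel h x d a b) N := by
  unfold christoffel
  refine contDiffOn_const.mul (ContDiffOn.sum fun e _ => ?_)
  refine (contDiffOn_inv hm.smooth hm.nondeg d e).mul ?_
  exact ((contDiffOn_pd hm.isOpen (hm.smooth _ _) _).add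
    (contDiffOn_pd hm.isOpen (hm.smooth _ _) _)).sub
    (contDiffOn_pd hm.isOpen (hm.smooth _ _) _)

lemma IsMetricOn.smooth_covDeriv (hm : IsMetricOn N h) {k : ℕ} {T : TensorField 𝕜 k}
    (hT : SmoothTensor N T) : SmoothTensor N (covDeriv h T) := by
  intro I
  unfold covDeriv
  refine (contDiffOn_pd hm.isOpen (hT _) _).sub ?_
  refine ContDiffOn.sum fun j _ => ContDiffOn.sum fun d _ => ?_
  exact (hm.contDiffOn_christoffel _ _ _).mul (hT _)

lemma IsMetricOn.pd_congr_symm (hm : IsMetricOn N h) {x : Pt 𝕜} (hx : x ∈ N) (a b c : Fin 3) :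
    pd (fun y => h y a b) c x = pd (fun y => h y b a) c x := by
  unfold pd
  rw [Filter.EventuallyEq.fderiv_eq]
  filter_upwards [hm.isOpen.mem_nhds hx] with y hy
  exact (hm.symm y hy).apply b a

lemma IsMetricOn.christoffel_symm (hm : IsMetricOn N h) {x : Pt 𝕜} (hx : x ∈ N)
    (d a b : Fin 3) : christoffel h x d a b = christoffel h x d b a := by
  unfold christoffel
  congr 1
  refine Finset.sum_congr rfl fun e _ => ?_
  rw [hm.pd_congr_symm hx a b e]
  ring

lemma IsMetricOn.lower_christoffel (hm : IsMetricOn N h) {x : Pt 𝕜} (hx : x ∈ N)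
    (e a b : Fin 3) : ∑ d, h x e d * christoffel h x d a b =
      (1 / 2) * (pd (fun y => h y b e) a x + pd (fun y => h y a e) b x -
        pd (fun y => h y a b) e x) := by
  unfold christoffel
  set w : Fin 3 → 𝕜 := fun e => pd (fun y => h y b e) a x + pd (fun y => h y a e) b x -
        pd (fun y => h y a b) e x
  have h1 : ∑ d, h x e d * (1 / 2 * ∑ f, (h x)⁻¹ d f * w f) =
      (1 / 2) * ((h x).mulVec ((h x)⁻¹.mulVec w)) e := by
    simp only [Matrix.mulVec, dotProduct, Finset.mul_sum]
    exact Finset.sum_congr rfl fun d _ => Finset.sum_congr rfl fun f _ => by ring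
  change ∑ d, h x e d * (1 / 2 * ∑ f, (h x)⁻¹ d f * w f) = 1 / 2 * w e
  rw [h1, Matrix.mulVec_mulVec, Matrix.mul_nonsing_inv _ (hm.nondeg x hx).isUnit,
    Matrix.one_mulVec]

/-- The metric as a tensor field. -/
def metricTensor (h : Pt 𝕜 → Matrix (Fin 3) (Fin 3) 𝕜) : TensorField 𝕜 2 :=
  fun x I => h x (I 0) (I 1)

/-- Lowering the Christoffel symbols in two ways and adding leaves exactly the partial derivative of
the metric. -/
lemma IsMetricOn.covDeriv_metric (hm : IsMetricOn N h) {x : Pt 𝕜} (hx : x ∈ N)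
    (I : Fin 3 → Fin 3) : covDeriv h (metricTensor h) x I = 0 := by
  have key : ∀ a b c : Fin 3, pd (fun y => h y b c) a x -
      (∑ d, christoffel h x d a b * h x d c + ∑ d, christoffel h x d a c * h x b d) = 0 := by
    intro a b c
    have h1 := hm.lower_christoffel hx c a b
    have h2 := hm.lower_christoffel hx b a c
    have e1 : ∑ d, christoffel h x d a b * h x d c = ∑ d, h x c d * christoffel h x d a b :=
      Finset.sum_congr rfl fun d _ => by rw [(hm.symm x hx).apply c d, mul_comm]
    have e2 : ∑ d, christoffel h x d a c * h x b d = ∑ d, h x b d * christoffel h x d a c :=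
      Finset.sum_congr rfl fun d _ => by rw [mul_comm]
    rw [e1, e2, h1, h2, hm.pd_congr_symm hx c b a, hm.pd_congr_symm hx a b c,
      hm.pd_congr_symm hx a c b]
    ring
  have := key (I 0) (I 1) (I 2)
  simpa [covDeriv, metricTensor, Fin.sum_univ_two, Fin.tail] using this

/-- Replacing a slot: frame components of a tensor with the `j`-th frame vector replaced by a
linear combination of the frame. -/
lemma sum_prod_erase_replace {k : ℕ} (c : Fin 3 → Fin 3 → 𝕜) (t : (Fin k → Fin 3) → 𝕜)
    (I : Fin k → Fin 3) (j : Fin k) (A : Fin 3 → 𝕜) :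
    ∑ K : Fin k → Fin 3, (∏ l ∈ Finset.univ.erase j, c (I l) (K l)) *
      (∑ d, A d * c d (K j)) * t K = ∑ d, A d * frameComp c t (Function.update I j d) := by
  simp only [frameComp, Finset.mul_sum, Finset.sum_mul]
  rw [Finset.sum_comm]
  refine Finset.sum_congr rfl fun d _ => Finset.sum_congr rfl fun K _ => ?_
  rw [← Finset.mul_prod_erase _ _ (Finset.mem_univ j)]
  have : ∏ l ∈ Finset.univ.erase j, c (Function.update I j d l) (K l) =
      ∏ l ∈ Finset.univ.erase j, c (I l) (K l) :=
    Finset.prod_congr rfl fun l hl => by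
      rw [Function.update_of_ne (Finset.ne_of_mem_erase hl)]
  rw [this, Function.update_self]
  ring

/-- Leibniz rule for a product that is linear in each frame vector: the base part of `v`
differentiates the tensor, the frame part acts on one slot at a time. -/
lemma fderiv_comp_apply {k : ℕ} {T : TensorField 𝕜 k} {p : Fr 𝕜}
    (hT : ∀ K, DifferentiableAt 𝕜 (fun x => T x K) p.1) (I : Fin k → Fin 3) (v : Fr 𝕜) :
    fderiv 𝕜 (comp T I) p v =
      ∑ K : Fin k → Fin 3, (∏ j, p.2 (I j) (K j)) * fderiv 𝕜 (fun x => T x K) p.1 v.1 +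
      ∑ j, ∑ K : Fin k → Fin 3, (∏ l ∈ Finset.univ.erase j, p.2 (I l) (K l)) *
        v.2 (I j) (K j) * T p.1 K := by
  have hc : ∀ b n : Fin 3, HasFDerivAt (fun q : Fr 𝕜 => q.2 b n)
      ((ContinuousLinearMap.proj n).comp ((ContinuousLinearMap.proj b).comp
        (ContinuousLinearMap.snd 𝕜 (Pt 𝕜) (Fin 3 → Fin 3 → 𝕜)))) p := fun b n =>
    ContinuousLinearMap.hasFDerivAt ((ContinuousLinearMap.proj (R := 𝕜) n).comp
      ((ContinuousLinearMap.proj b).comp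
        (ContinuousLinearMap.snd 𝕜 (Pt 𝕜) (Fin 3 → Fin 3 → 𝕜))))
  have hTK : ∀ K, HasFDerivAt (fun q : Fr 𝕜 => T q.1 K)
      ((fderiv 𝕜 (fun x => T x K) p.1).comp
        (ContinuousLinearMap.fst 𝕜 (Pt 𝕜) (Fin 3 → Fin 3 → 𝕜))) p := fun K =>
    (hT K).hasFDerivAt.comp p hasFDerivAt_fst
  have hprod := fun K : Fin k → Fin 3 => HasFDerivAt.finsetProd (u := Finset.univ)
    (fun j (_ : j ∈ Finset.univ) => hc (I j) (K j))
  have hsum := HasFDerivAt.fun_sum (u := (Finset.univ : Finset (Fin k → Fin 3)))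
    (fun K _ => (hprod K).mul (hTK K))
  have : fderiv 𝕜 (comp T I) p = _ := hsum.fderiv
  rw [this]
  rw [Finset.sum_comm, ← Finset.sum_add_distrib]
  simp only [sum_apply]
  refine Finset.sum_congr rfl fun K _ => ?_
  simp [Finset.mul_sum]
  refine Finset.sum_congr rfl fun j _ => ?_
  ring

lemma fderiv_eq_sum_pd (f : Pt 𝕜 → 𝕜) (x v : Pt 𝕜) :
    fderiv 𝕜 f x v = ∑ m, v m * pd f m x := by
  conv_lhs => rw [pi_eq_sum_univ' v]
  simp only [map_sum, map_smul, smul_eq_mul, pd]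

lemma sum_fin_succ_arrow {M : Type*} [AddCommMonoid M] {k : ℕ} (G : (Fin (k + 1) → Fin 3) → M) :
    ∑ K, G K = ∑ m, ∑ K : Fin k → Fin 3, G (Fin.cons m K) := by
  rw [← (Fin.consEquiv (fun _ => Fin 3)).sum_comp, Fintype.sum_prod_type]
  rfl

/-- The horizontal derivatives of the frame components of a tensor field are the frame components
of its covariant derivative. -/
lemma horDeriv_comp {k : ℕ} {T : TensorField 𝕜 k} {p : Fr 𝕜}
    (hT : ∀ K, DifferentiableAt 𝕜 (fun x => T x K) p.1) (a : Fin 3) (I : Fin k → Fin 3) :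
    horDeriv h a (comp T I) p = comp (covDeriv h T) (Fin.cons a I) p := by
  rw [horDeriv, fderiv_comp_apply hT]
  simp only [comp, frameComp]
  rw [sum_fin_succ_arrow]
  simp only [covDeriv, Fin.cons_zero, Fin.tail_cons, Fin.prod_univ_succ, Fin.cons_succ, mul_sub,
    Finset.sum_sub_distrib]
  rw [sub_eq_add_neg]
  congr 1
  · simp only [hor, fderiv_eq_sum_pd, Finset.mul_sum]
    rw [Finset.sum_comm]
    exact Finset.sum_congr rfl fun m _ => Finset.sum_congr rfl fun K _ => by ring
  · have hj : ∀ j, ∑ K : Fin k → Fin 3, (∏ l ∈ Finset.univ.erase j, p.2 (I l) (K l)) *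
        (hor h a p).2 (I j) (K j) * T p.1 K =
        - ∑ K : Fin k → Fin 3, ∑ d, ∑ m, p.2 a m * (∏ l, p.2 (I l) (K l)) *
          (christoffel h p.1 d m (K j) * T p.1 (Function.update K j d)) := by
      intro j
      -- The frame part of `hor` carries the Christoffel symbols with upper index `K j`. Exchanging
      -- `K j` with the summed lower index turns them into the slot-wise correction of `covDeriv`.
      have h1 := sum_update_swap j (fun (K : Fin k → Fin 3) s => ∑ m, p.2 a m *
        ((∏ l ∈ Finset.univ.erase j, p.2 (I l) (K l)) * p.2 (I j) s) *
          (christoffel h p.1 (K j) m s * T p.1 K))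
      have h2 : ∀ (K : Fin k → Fin 3) s, ∏ l ∈ Finset.univ.erase j,
          p.2 (I l) (Function.update K j s l) = ∏ l ∈ Finset.univ.erase j, p.2 (I l) (K l) :=
        fun K s => Finset.prod_congr rfl fun l hl => by
          rw [Function.update_of_ne (Finset.ne_of_mem_erase hl)]
      simp only [h2, Function.update_self, Finset.prod_erase_mul _ _ (Finset.mem_univ j)] at h1
      rw [h1, ← Finset.sum_neg_distrib]
      refine Finset.sum_congr rfl fun K _ => ?_
      simp only [hor, mul_neg, neg_mul, Finset.mul_sum, Finset.sum_mul]
      rw [Finset.sum_comm]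
      congr 1
      exact Finset.sum_congr rfl fun m _ => Finset.sum_congr rfl fun l _ => by ring
    rw [Finset.sum_congr rfl fun j _ => hj j, Finset.sum_neg_distrib]
    congr 1
    rw [Finset.sum_comm, Finset.sum_comm (s := (Finset.univ : Finset (Fin 3)))]
    refine Finset.sum_congr rfl fun K _ => ?_
    simp only [Finset.mul_sum]
    rw [Finset.sum_comm (s := (Finset.univ : Finset (Fin 3)))]
    refine Finset.sum_congr rfl fun j _ => ?_
    rw [Finset.sum_comm]

/-- The infinitesimal action of the general linear group on frame components; it evaluates the
curvature term in commutators. -/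
lemma fderiv_comp_vertical {k : ℕ} {T : TensorField 𝕜 k} {p : Fr 𝕜}
    (hT : ∀ K, DifferentiableAt 𝕜 (fun x => T x K) p.1) (I : Fin k → Fin 3)
    (A : Fin 3 → Fin 3 → 𝕜) :
    fderiv 𝕜 (comp T I) p (0, fun e n => ∑ d, A e d * p.2 d n) =
      ∑ j, ∑ d, A (I j) d * comp T (Function.update I j d) p := by
  rw [fderiv_comp_apply hT]
  simp only [map_zero, mul_zero, Finset.sum_const_zero, zero_add]
  exact Finset.sum_congr rfl fun j _ => sum_prod_erase_replace p.2 (T p.1) I j (A (I j))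

/-- The Riemann tensor `R^n_{q m l}` in coordinates. -/
def riem (h : Pt 𝕜 → Matrix (Fin 3) (Fin 3) 𝕜) (x : Pt 𝕜) (n q m l : Fin 3) : 𝕜 :=
  pd (fun y => christoffel h y n l q) m x - pd (fun y => christoffel h y n m q) l x +
    ∑ r, (christoffel h x n m r * christoffel h x r l q -
      christoffel h x n l r * christoffel h x r m q)

lemma hasFDerivAt_frame_coord (p : Fr 𝕜) (b n : Fin 3) : HasFDerivAt (fun q : Fr 𝕜 => q.2 b n)
      ((ContinuousLinearMap.proj n).comp ((ContinuousLinearMap.proj b).comp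
        (ContinuousLinearMap.snd 𝕜 (Pt 𝕜) (Fin 3 → Fin 3 → 𝕜)))) p :=
  ContinuousLinearMap.hasFDerivAt ((ContinuousLinearMap.proj (R := 𝕜) n).comp
      ((ContinuousLinearMap.proj b).comp
        (ContinuousLinearMap.snd 𝕜 (Pt 𝕜) (Fin 3 → Fin 3 → 𝕜))))

lemma IsMetricOn.contDiffOn_hor (hm : IsMetricOn N h) (b : Fin 3) :
    ContDiffOn 𝕜 ∞ (hor h b) (frameDomain N) := by
  refine ContDiffOn.prodMk ((contDiff_pi.1 contDiff_snd b).contDiffOn) ?_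
  refine contDiffOn_pi.2 fun e => contDiffOn_pi.2 fun n => ContDiffOn.neg ?_
  refine ContDiffOn.sum fun m _ => ContDiffOn.sum fun l _ => ?_
  refine (ContDiffOn.mul ?_ (contDiff_frame_coord _ _).contDiffOn).mul
    (contDiff_frame_coord _ _).contDiffOn
  exact (hm.contDiffOn_christoffel _ _ _).comp contDiff_fst.contDiffOn fun p hp => hp.1

lemma IsMetricOn.differentiableAt_christoffel (hm : IsMetricOn N h) {x : Pt 𝕜} (hx : x ∈ N)
    (n m l : Fin 3) : DifferentiableAt 𝕜 (fun y => christoffel h y n m l) x :=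
  ((hm.contDiffOn_christoffel n m l).contDiffAt (hm.isOpen.mem_nhds hx)).differentiableAt (by simp)

lemma IsMetricOn.fderiv_hor (hm : IsMetricOn N h) {p : Fr 𝕜} (hp : p ∈ frameDomain N)
    (b : Fin 3) (v : Fr 𝕜) :
    fderiv 𝕜 (hor h b) p v = (v.2 b, fun e n => - ∑ m, ∑ l,
      (fderiv 𝕜 (fun y => christoffel h y n m l) p.1 v.1 * p.2 b m * p.2 e l +
        christoffel h p.1 n m l * v.2 b m * p.2 e l +
        christoffel h p.1 n m l * p.2 b m * v.2 e l)) := by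
  have hd : DifferentiableAt 𝕜 (hor h b) p :=
    ((hm.contDiffOn_hor b).contDiffAt ((isOpen_frameDomain hm.isOpen).mem_nhds hp)).differentiableAt
      (by simp)
  apply Prod.ext
  · change (fderiv 𝕜 (hor h b) p v).1 = v.2 b
    funext n
    have h1 := hd.hasFDerivAt.fst
    have h2 := (hasFDerivAt_pi'.1 h1 n).unique (hasFDerivAt_frame_coord p b n)
    exact congrArg (fun L => L v) h2
  · funext e n
    have h1 := hd.hasFDerivAt.snd
    have hΓ : ∀ m l, HasFDerivAt (fun q : Fr 𝕜 => christoffel h q.1 n m l)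
      ((fderiv 𝕜 (fun y => christoffel h y n m l) p.1).comp
        (ContinuousLinearMap.fst 𝕜 (Pt 𝕜) (Fin 3 → Fin 3 → 𝕜))) p := fun m l =>
      (hm.differentiableAt_christoffel hp.1 n m l).hasFDerivAt.comp p hasFDerivAt_fst
    have h3 := (HasFDerivAt.fun_sum (u := (Finset.univ : Finset (Fin 3))) fun m _ =>
      HasFDerivAt.fun_sum (u := (Finset.univ : Finset (Fin 3))) fun l _ =>
      ((hΓ m l).mul (hasFDerivAt_frame_coord p b m)).mul (hasFDerivAt_frame_coord p e l)).neg
    have h2 := (hasFDerivAt_pi'.1 (hasFDerivAt_pi'.1 h1 e) n).unique h3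
    have h4 := congrArg (fun L => L v) h2
    refine h4.trans ?_
    simp only [neg_apply, sum_apply]
    congr 1
    refine Finset.sum_congr rfl fun m _ => Finset.sum_congr rfl fun l _ => ?_
    simp
    ring

/-- The base component of the bracket vanishes because the connection is torsion-free; the frame
component is the curvature. -/
lemma IsMetricOn.bracket_hor (hm : IsMetricOn N h) {p : Fr 𝕜} (hp : p ∈ frameDomain N)
    (a b : Fin 3) :
    fderiv 𝕜 (hor h b) p (hor h a p) - fderiv 𝕜 (hor h a) p (hor h b p) =
      (0, fun e n => - ∑ q, ∑ m, ∑ l, riem h p.1 n q m l * p.2 a m * p.2 b l * p.2 e q) := by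
  have hs := fun n m l => hm.christoffel_symm hp.1 n m l
  rw [hm.fderiv_hor hp, hm.fderiv_hor hp]
  apply Prod.ext
  · funext n
    simp only [hor, Prod.fst_sub, Pi.sub_apply, Pi.zero_apply]
    rw [sub_eq_zero, Finset.sum_comm]
    congr 1
    exact Finset.sum_congr rfl fun m _ => Finset.sum_congr rfl fun l _ => by rw [hs]; ring
  · funext e n
    simp only [hor, Prod.snd_sub, Pi.sub_apply, riem, fderiv_eq_sum_pd]
    generalize christoffel h p.1 = G at hs ⊢
    generalize p.2 a = u
    generalize p.2 b = v
    generalize p.2 e = w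
    simp only [Fin.sum_univ_three]
    simp only [hs _ 1 0, hs _ 2 0, hs _ 2 1]
    ring

/-- The second derivatives of `f` cancel by symmetry, and only the bracket of the two horizontal
fields remains. -/
lemma IsMetricOn.horDeriv_comm (hm : IsMetricOn N h) {p : Fr 𝕜} (hp : p ∈ frameDomain N)
    {f : Fr 𝕜 → 𝕜} (hf : ContDiffOn 𝕜 ∞ f (frameDomain N)) (a b : Fin 3) :
    horDeriv h a (horDeriv h b f) p - horDeriv h b (horDeriv h a f) p =
      fderiv 𝕜 f p (0, fun e n =>
        - ∑ q, ∑ m, ∑ l, riem h p.1 n q m l * p.2 a m * p.2 b l * p.2 e q) := by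
  have hU := (isOpen_frameDomain hm.isOpen).mem_nhds hp
  have hfa : ContDiffAt 𝕜 ∞ f p := hf.contDiffAt hU
  have hf' : DifferentiableAt 𝕜 (fderiv 𝕜 f) p :=
    (hfa.fderiv_right (m := 1) (by norm_cast)).differentiableAt (by simp)
  have hd : ∀ b, DifferentiableAt 𝕜 (hor h b) p := fun b =>
    ((hm.contDiffOn_hor b).contDiffAt hU).differentiableAt (by simp)
  have key : ∀ a b, horDeriv h a (horDeriv h b f) p =
      fderiv 𝕜 (fderiv 𝕜 f) p (hor h a p) (hor h b p) +
        fderiv 𝕜 f p (fderiv 𝕜 (hor h b) p (hor h a p)) := by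
    intro a b
    have := (hf'.hasFDerivAt.clm_apply (hd b).hasFDerivAt).fderiv
    have h2 := congrArg (fun L => L (hor h a p)) this
    refine Eq.trans h2 ?_
    simp [add_comm]
  have hsymm : IsSymmSndFDerivAt 𝕜 f p := hfa.isSymmSndFDerivAt (by simp; exact WithTop.coe_le_coe.2 le_top)
  rw [key, key, hsymm.eq (hor h b p) (hor h a p), ← hm.bracket_hor hp a b, map_sub]
  ring

end FrameBundle

/-! ### Pairs of frame bundles and agreement to finite order -/

section FramePair

variable {𝕜 : Type*} [RCLike 𝕜]

/-- The components of the metric in a frame. -/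
def frameMetric (h : Pt 𝕜 → Matrix (Fin 3) (Fin 3) 𝕜) (p : Fr 𝕜) : Matrix (Fin 3) (Fin 3) 𝕜 :=
  Matrix.of p.2 * h p.1 * (Matrix.of p.2).transpose

/-- Two metrics with a distinguished orthonormal frame each, and a homomorphism of the ground
field along which components in the two frames are compared. -/
structure FramePair (𝕜 : Type*) [RCLike 𝕜] where
  /-- The domains. -/
  N : Bool → Set (Pt 𝕜)
  /-- The metrics. -/
  h : Bool → Pt 𝕜 → Matrix (Fin 3) (Fin 3) 𝕜
  /-- The distinguished frames. -/
  pt : Bool → Fr 𝕜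
  /-- The homomorphism used for the comparison. -/
  θ : 𝕜 →+* 𝕜
  /-- The sign of the metric. -/
  sgn : ℤˣ
  metric : ∀ b, IsMetricOn (N b) (h b)
  mem : ∀ b, pt b ∈ frameDomain (N b)
  orthonormal : ∀ b, frameMetric (h b) (pt b) = ((sgn : ℤ) : 𝕜) • (1 : Matrix (Fin 3) (Fin 3) 𝕜)

/-- Pairs of functions on the two frame bundles. -/
abbrev FunPair (𝕜 : Type*) := Bool → Fr 𝕜 → 𝕜

namespace FramePair

variable (P : FramePair 𝕜)

/-- The two frame bundles. -/
def U (b : Bool) : Set (Fr 𝕜) := frameDomain (P.N b)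

lemma isOpen_U (b : Bool) : IsOpen (P.U b) := isOpen_frameDomain (P.metric b).isOpen

/-- Smoothness of a pair of functions. -/
def Smooth (f : FunPair 𝕜) : Prop := ∀ b, ContDiffOn 𝕜 ∞ (f b) (P.U b)

/-- Equality of two pairs of functions on the frame bundles. -/
def EqU (f g : FunPair 𝕜) : Prop := ∀ b, Set.EqOn (f b) (g b) (P.U b)

/-- Agreement of the values at the distinguished frames. -/
def Matches (f : FunPair 𝕜) : Prop := f true (P.pt true) = P.θ (f false (P.pt false))

/-- The horizontal derivative of a pair of functions. -/
def E (a : Fin 3) (f : FunPair 𝕜) : FunPair 𝕜 := fun b => horDeriv (P.h b) a (f b)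

/-- Agreement of all horizontal derivatives of order less than `k`. -/
def Agr : ℕ → FunPair 𝕜 → Prop
  -- Order zero demands no matching of values, so the truncated `n - 1` at `n = 0` later on requires
  -- smoothness only.
  | 0, f => P.Smooth f
  | k + 1, f => P.Smooth f ∧ P.Matches f ∧ ∀ a, Agr k (P.E a f)

variable {P}

lemma EqU.symm {f g : FunPair 𝕜} (h : P.EqU f g) : P.EqU g f := fun b => (h b).symm

lemma EqU.E {f g : FunPair 𝕜} (h : P.EqU f g) (a : Fin 3) : P.EqU (P.E a f) (P.E a g) := by
  intro b p hp
  unfold FramePair.E horDeriv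
  rw [Filter.EventuallyEq.fderiv_eq]
  filter_upwards [(P.isOpen_U b).mem_nhds hp] with q hq
  exact h b hq

lemma Smooth.differentiableAt {f : FunPair 𝕜} (hf : P.Smooth f) {b : Bool} {p : Fr 𝕜}
    (hp : p ∈ P.U b) : DifferentiableAt 𝕜 (f b) p :=
  ((hf b).contDiffAt ((P.isOpen_U b).mem_nhds hp)).differentiableAt (by simp)

lemma Smooth.E {f : FunPair 𝕜} (hf : P.Smooth f) (a : Fin 3) : P.Smooth (P.E a f) := fun b =>
  ((hf b).fderiv_of_isOpen (P.isOpen_U b) (by simp)).clm_apply ((P.metric b).contDiffOn_hor a)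

lemma Agr.smooth {k : ℕ} {f : FunPair 𝕜} (h : P.Agr k f) : P.Smooth f := by
  cases k with
  | zero => exact h
  | succ k => exact h.1

lemma Agr.matches {k : ℕ} {f : FunPair 𝕜} (h : P.Agr (k + 1) f) : P.Matches f := h.2.1

lemma Agr.E {k : ℕ} {f : FunPair 𝕜} (h : P.Agr (k + 1) f) (a : Fin 3) : P.Agr k (P.E a f) :=
  h.2.2 a

lemma Agr.congr {k : ℕ} {f g : FunPair 𝕜} (h : P.Agr k f) (hfg : P.EqU f g) : P.Agr k g := by
  induction k generalizing f g with
  | zero => exact fun b => (h b).congr (hfg b).symm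
  | succ k ih =>
    refine ⟨fun b => (h.smooth b).congr (hfg b).symm, ?_, fun a => ih (h.E a) (hfg.E a)⟩
    have := h.matches
    unfold Matches at this ⊢
    rw [← hfg true (P.mem true), ← hfg false (P.mem false), this]

lemma Agr.pred {k : ℕ} {f : FunPair 𝕜} (h : P.Agr (k + 1) f) : P.Agr k f := by
  induction k generalizing f with
  | zero => exact h.smooth
  | succ k ih => exact ⟨h.smooth, h.matches, fun a => ih (h.E a)⟩

lemma Agr.mono {k l : ℕ} {f : FunPair 𝕜} (h : P.Agr l f) (hkl : k ≤ l) : P.Agr k f := by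
  induction hkl with
  | refl => exact h
  | step _ ih => exact ih h.pred

lemma E_add {f g : FunPair 𝕜} (hf : P.Smooth f) (hg : P.Smooth g) (a : Fin 3) :
    P.EqU (P.E a (fun b p => f b p + g b p)) (fun b p => P.E a f b p + P.E a g b p) := by
  intro b p hp
  simp only [FramePair.E, horDeriv]
  rw [fderiv_fun_add (hf.differentiableAt hp) (hg.differentiableAt hp)]
  rfl

lemma E_mul {f g : FunPair 𝕜} (hf : P.Smooth f) (hg : P.Smooth g) (a : Fin 3) :
    P.EqU (P.E a (fun b p => f b p * g b p))
      (fun b p => f b p * P.E a g b p + g b p * P.E a f b p) := by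
  intro b p hp
  simp only [FramePair.E, horDeriv]
  rw [fderiv_fun_mul (hf.differentiableAt hp) (hg.differentiableAt hp)]
  rfl

lemma E_const (r : 𝕜) (a : Fin 3) : P.E a (fun _ _ => r) = fun _ _ => 0 := by
  funext b p
  simp [FramePair.E, horDeriv]

/-- Only constants fixed by `θ` are admissible; the coefficients of the field equations are
rational, so they qualify. -/
lemma Agr.const {k : ℕ} {r : 𝕜} (hr : P.θ r = r) : P.Agr k (fun _ _ => r) := by
  induction k generalizing r with
  | zero => exact fun b => contDiffOn_const
  | succ k ih =>
    refine ⟨fun b => contDiffOn_const, hr.symm, fun a => ?_⟩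
    rw [E_const]
    exact ih (map_zero _)

/-- This and the following closure rules combine two facts: `θ` respects the ring operations, and a
horizontal derivative is a derivation. -/
lemma Agr.add {k : ℕ} {f g : FunPair 𝕜} (hf : P.Agr k f) (hg : P.Agr k g) :
    P.Agr k (fun b p => f b p + g b p) := by
  induction k generalizing f g with
  | zero => exact fun b => (hf b).add (hg b)
  | succ k ih =>
    refine ⟨fun b => (hf.smooth b).add (hg.smooth b), ?_, fun a => ?_⟩
    · have h1 := hf.matches
      have h2 := hg.matches
      unfold Matches at *
      beta_reduce
      rw [h1, h2, map_add]
    · exact (ih (hf.E a) (hg.E a)).congr (E_add hf.smooth hg.smooth a).symm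

lemma Agr.mul {k : ℕ} {f g : FunPair 𝕜} (hf : P.Agr k f) (hg : P.Agr k g) :
    P.Agr k (fun b p => f b p * g b p) := by
  induction k generalizing f g with
  | zero => exact fun b => (hf b).mul (hg b)
  | succ k ih =>
    refine ⟨fun b => (hf.smooth b).mul (hg.smooth b), ?_, fun a => ?_⟩
    · have h1 := hf.matches
      have h2 := hg.matches
      unfold Matches at *
      beta_reduce
      rw [h1, h2, map_mul]
    · exact ((ih hf.pred (hg.E a)).add (ih hg.pred (hf.E a))).congr
        (E_mul hf.smooth hg.smooth a).symm

lemma Agr.neg {k : ℕ} {f : FunPair 𝕜} (hf : P.Agr k f) : P.Agr k (fun b p => - f b p) :=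
  ((Agr.const (r := -1) (by simp)).mul hf).congr fun b p _ => by simp

lemma Agr.sub {k : ℕ} {f g : FunPair 𝕜} (hf : P.Agr k f) (hg : P.Agr k g) :
    P.Agr k (fun b p => f b p - g b p) :=
  (hf.add hg.neg).congr fun b p _ => by simp [sub_eq_add_neg]

lemma Agr.pow {k : ℕ} {f : FunPair 𝕜} (hf : P.Agr k f) (n : ℕ) :
    P.Agr k (fun b p => f b p ^ n) := by
  induction n with
  | zero => exact (Agr.const (r := 1) (by simp)).congr fun b p _ => by simp
  | succ n ih => exact (ih.mul hf).congr fun b p _ => by simp [pow_succ]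

lemma Agr.sum {k : ℕ} {ι : Type*} {s : Finset ι} {f : ι → FunPair 𝕜}
    (hf : ∀ i ∈ s, P.Agr k (f i)) : P.Agr k (fun b p => ∑ i ∈ s, f i b p) := by
  classical
  induction s using Finset.induction_on with
  | empty => exact (Agr.const (r := 0) (by simp)).congr fun b p _ => by simp
  | insert i s hi ih =>
    refine ((hf i (Finset.mem_insert_self i s)).add
      (ih fun j hj => hf j (Finset.mem_insert_of_mem hj))).congr fun b p _ => ?_
    simp [Finset.sum_insert hi]

/-- The derivative of the inverse is obtained by differentiating `f * f⁻¹ = 1`; it involves the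
inverse only to lower order, so induction applies. -/
lemma Agr.inv {k : ℕ} {f : FunPair 𝕜} (hf : P.Agr k f) (h0 : ∀ b, ∀ p ∈ P.U b, f b p ≠ 0) :
    P.Agr k (fun b p => (f b p)⁻¹) := by
  induction k with
  | zero => exact fun b => (hf b).inv (h0 b)
  | succ k ih =>
    refine ⟨fun b => (hf.smooth b).inv (h0 b), ?_, fun a => ?_⟩
    · have h1 := hf.matches
      unfold Matches at *
      beta_reduce
      rw [h1, map_inv₀]
    · have hi := ih hf.pred
      refine ((hi.mul hi).mul (hf.E a)).neg.congr fun b p hp => ?_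
      have h1 : P.EqU (fun b p => f b p * (f b p)⁻¹) (fun _ _ => 1) := fun b p hp =>
        mul_inv_cancel₀ (h0 b p hp)
      have h2 := h1.E a b hp
      rw [E_const, E_mul (g := fun b p => (f b p)⁻¹) hf.smooth
        (fun b => (hf.smooth b).inv (h0 b)) a b hp] at h2
      have h3 := h0 b p hp
      beta_reduce at h2 ⊢
      rw [← mul_right_inj' h3, eq_neg_of_add_eq_zero_left h2]
      field_simp

lemma Agr.div {k : ℕ} {f g : FunPair 𝕜} (hf : P.Agr k f) (hg : P.Agr k g)
    (h0 : ∀ b, ∀ p ∈ P.U b, g b p ≠ 0) : P.Agr k (fun b p => f b p / g b p) :=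
  (hf.mul (hg.inv h0)).congr fun b p _ => by simp [div_eq_mul_inv]

lemma Smooth.agr_succ {k : ℕ} {f : FunPair 𝕜} (hf : P.Smooth f) (h0 : P.Matches f)
    (h : ∀ a, P.Agr k (P.E a f)) : P.Agr (k + 1) f := ⟨hf, h0, h⟩

lemma Agr.of_E_eq_zero {k : ℕ} {f : FunPair 𝕜} (hf : P.Smooth f) (h0 : P.Matches f)
    (h : ∀ a, P.EqU (P.E a f) (fun _ _ => 0)) : P.Agr k f := by
  cases k with
  | zero => exact hf
  | succ k => exact ⟨hf, h0, fun a => (Agr.const (map_zero _)).congr (h a).symm⟩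

end FramePair

end FramePair

/-! ### Metric, Riemann tensor and Ricci identity in a frame -/

section FramePair

variable {𝕜 : Type*} [RCLike 𝕜]

lemma comp_one (T : TensorField 𝕜 1) (a : Fin 3) (p : Fr 𝕜) :
    comp T ![a] p = ∑ m, p.2 a m * T p.1 ![m] := by
  simp only [comp, frameComp, sum_fin_succ_arrow]
  simp
  rfl

lemma comp_two (T : TensorField 𝕜 2) (a b : Fin 3) (p : Fr 𝕜) :
    comp T ![a, b] p = ∑ m, ∑ n, p.2 a m * p.2 b n * T p.1 ![m, n] := by
  simp only [comp, frameComp, sum_fin_succ_arrow]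
  simp [Fin.prod_univ_succ]
  rfl

lemma comp_three (T : TensorField 𝕜 3) (a b c : Fin 3) (p : Fr 𝕜) :
    comp T ![a, b, c] p =
      ∑ m, ∑ n, ∑ l, p.2 a m * (p.2 b n * p.2 c l) * T p.1 ![m, n, l] := by
  simp only [comp, frameComp, sum_fin_succ_arrow]
  simp [Fin.prod_univ_succ]
  rfl

lemma comp_four (T : TensorField 𝕜 4) (a b c d : Fin 3) (p : Fr 𝕜) :
    comp T ![a, b, c, d] p = ∑ m, ∑ n, ∑ l, ∑ q,
      p.2 a m * (p.2 b n * (p.2 c l * p.2 d q)) * T p.1 ![m, n, l, q] := by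
  simp only [comp, frameComp, sum_fin_succ_arrow]
  simp [Fin.prod_univ_succ]
  rfl

lemma frameMetric_apply (h : Pt 𝕜 → Matrix (Fin 3) (Fin 3) 𝕜) (p : Fr 𝕜) (a b : Fin 3) :
    frameMetric h p a b = ∑ m, ∑ n, p.2 a m * p.2 b n * h p.1 m n := by
  simp only [frameMetric, Matrix.mul_apply, Matrix.of_apply, Matrix.transpose_apply,
    Finset.sum_mul]
  rw [Finset.sum_comm]
  exact Finset.sum_congr rfl fun m _ => Finset.sum_congr rfl fun n _ => by ring

lemma comp_metricTensor (h : Pt 𝕜 → Matrix (Fin 3) (Fin 3) 𝕜) (p : Fr 𝕜) (a b : Fin 3) :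
    comp (metricTensor h) ![a, b] p = frameMetric h p a b := by
  rw [comp_two, frameMetric_apply]
  rfl

variable {N : Set (Pt 𝕜)} {h : Pt 𝕜 → Matrix (Fin 3) (Fin 3) 𝕜}

lemma IsMetricOn.det_frameMetric (hm : IsMetricOn N h) {p : Fr 𝕜} (hp : p ∈ frameDomain N) :
    (frameMetric h p).det ≠ 0 := by
  rw [frameMetric, Matrix.det_mul, Matrix.det_mul, Matrix.det_transpose]
  exact mul_ne_zero (mul_ne_zero hp.2 (hm.nondeg _ hp.1)) hp.2

lemma IsMetricOn.frameMetric_symm (hm : IsMetricOn N h) {p : Fr 𝕜} (hp : p ∈ frameDomain N)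
    (a b : Fin 3) : frameMetric h p a b = frameMetric h p b a := by
  rw [frameMetric_apply, frameMetric_apply, Finset.sum_comm]
  exact Finset.sum_congr rfl fun m _ => Finset.sum_congr rfl fun n _ => by
    rw [(hm.symm _ hp.1).apply]; ring

lemma inv_eq_frameMetric_inv {p : Fr 𝕜} (hp : p ∈ frameDomain N) :
    (h p.1)⁻¹ = (Matrix.of p.2).transpose * (frameMetric h p)⁻¹ * Matrix.of p.2 := by
  set C := Matrix.of p.2 with hC
  have hCu : IsUnit C.det := (show C.det ≠ 0 from hp.2).isUnit
  have hCt : IsUnit C.transpose.det := by rw [Matrix.det_transpose]; exact hCu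
  rw [frameMetric, Matrix.mul_inv_rev, Matrix.mul_inv_rev, ← hC]
  rw [← Matrix.mul_assoc, Matrix.mul_nonsing_inv _ hCt, Matrix.one_mul, Matrix.mul_assoc,
    Matrix.nonsing_inv_mul _ hCu, Matrix.mul_one]

lemma inv_apply_frame {p : Fr 𝕜} (hp : p ∈ frameDomain N)
    (m n : Fin 3) :
    (h p.1)⁻¹ m n = ∑ a, ∑ b, (frameMetric h p)⁻¹ a b * p.2 a m * p.2 b n := by
  rw [inv_eq_frameMetric_inv hp]
  simp only [Matrix.mul_apply, Matrix.of_apply, Matrix.transpose_apply, Finset.sum_mul]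
  rw [Finset.sum_comm]
  exact Finset.sum_congr rfl fun a _ => Finset.sum_congr rfl fun b _ => by ring

/-- The Riemann tensor with lowered index. -/
def riemTensor (h : Pt 𝕜 → Matrix (Fin 3) (Fin 3) 𝕜) : TensorField 𝕜 4 := fun x I =>
  ∑ n, h x (I 0) n * riem h x n (I 1) (I 2) (I 3)

lemma IsMetricOn.smooth_riemTensor (hm : IsMetricOn N h) : SmoothTensor N (riemTensor h) := by
  intro I
  refine ContDiffOn.sum fun n _ => (hm.smooth _ _).mul ?_
  have hΓ := hm.contDiffOn_christoffel
  refine ((contDiffOn_pd hm.isOpen (hΓ _ _ _) _).sub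
    (contDiffOn_pd hm.isOpen (hΓ _ _ _) _)).add (ContDiffOn.sum fun r _ => ?_)
  exact ((hΓ _ _ _).mul (hΓ _ _ _)).sub ((hΓ _ _ _).mul (hΓ _ _ _))

/-- The mixed components `R^d_{e a b}` of the Riemann tensor in a frame. -/
def riemUp (h : Pt 𝕜 → Matrix (Fin 3) (Fin 3) 𝕜) (d e a b : Fin 3) (p : Fr 𝕜) : 𝕜 :=
  ∑ f, (frameMetric h p)⁻¹ d f * comp (riemTensor h) ![f, e, a, b] p

/-- Writes the vertical part of the bracket as a combination of frame vectors, the shape required by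
`fderiv_comp_vertical`. -/
lemma IsMetricOn.riem_frame (hm : IsMetricOn N h) {p : Fr 𝕜} (hp : p ∈ frameDomain N)
    (e a b n : Fin 3) :
    ∑ q, ∑ m, ∑ l, riem h p.1 n q m l * p.2 a m * p.2 b l * p.2 e q =
      ∑ d, riemUp h d e a b p * p.2 d n := by
  set R : Fin 3 → 𝕜 := fun n =>
    ∑ q, ∑ m, ∑ l, riem h p.1 n q m l * p.2 a m * p.2 b l * p.2 e q with hR
  have h1 : ∀ f, comp (riemTensor h) ![f, e, a, b] p = ∑ m, p.2 f m * ((h p.1).mulVec R) m := by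
    intro f
    rw [comp_four]
    refine Finset.sum_congr rfl fun m _ => ?_
    simp only [riemTensor, Matrix.mulVec, dotProduct, hR, Finset.mul_sum, Matrix.cons_val_zero,
      Matrix.cons_val_one, Matrix.cons_val]
    simp only [Fin.sum_univ_three]
    ring
  have h2 : R n = ((h p.1)⁻¹.mulVec ((h p.1).mulVec R)) n := by
    rw [Matrix.mulVec_mulVec, Matrix.nonsing_inv_mul _ (hm.nondeg _ hp.1).isUnit,
      Matrix.one_mulVec]
  change R n = _
  rw [h2]
  simp only [riemUp, h1]
  generalize (h p.1).mulVec R = V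
  simp only [Matrix.mulVec, dotProduct]
  have h3 : ∀ m, (h p.1)⁻¹ n m = ∑ a, ∑ b, (frameMetric h p)⁻¹ a b * p.2 a n * p.2 b m :=
    inv_apply_frame hp n
  simp only [h3]
  simp only [Fin.sum_univ_three]
  ring

/-- The Ricci identity: the commutator contains no derivative of `T`, only curvature contracted into
each slot. -/
lemma IsMetricOn.horDeriv_comm_comp (hm : IsMetricOn N h) {p : Fr 𝕜} (hp : p ∈ frameDomain N)
    {k : ℕ} {T : TensorField 𝕜 k} (hT : SmoothTensor N T) (a b : Fin 3) (I : Fin k → Fin 3) :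
    horDeriv h a (horDeriv h b (comp T I)) p - horDeriv h b (horDeriv h a (comp T I)) p =
      - ∑ j, ∑ d, riemUp h d (I j) a b p * comp T (Function.update I j d) p := by
  rw [hm.horDeriv_comm hp (contDiffOn_comp hT I)]
  simp only [hm.riem_frame hp, ← Finset.sum_neg_distrib, ← neg_mul]
  exact fderiv_comp_vertical (fun K => ((hT K).contDiffAt
    (hm.isOpen.mem_nhds hp.1)).differentiableAt (by simp)) I
    (fun e d => - riemUp h d e a b p)

lemma riemTensor_antisymm (h : Pt 𝕜 → Matrix (Fin 3) (Fin 3) 𝕜) (f e a b : Fin 3) (p : Fr 𝕜) :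
    comp (riemTensor h) ![f, e, a, b] p = - comp (riemTensor h) ![f, e, b, a] p := by
  rw [comp_four, comp_four]
  simp only [← Finset.sum_neg_distrib]
  refine Finset.sum_congr rfl fun m _ => Finset.sum_congr rfl fun n _ => ?_
  rw [Finset.sum_comm]
  refine Finset.sum_congr rfl fun l _ => Finset.sum_congr rfl fun q _ => ?_
  have : riemTensor h p.1 ![m, n, q, l] = - riemTensor h p.1 ![m, n, l, q] := by
    simp only [riemTensor, riem, ← Finset.sum_neg_distrib, Finset.sum_sub_distrib]
    refine Finset.sum_congr rfl fun r _ => ?_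
    simp
    ring
  rw [this]
  ring

lemma IsMetricOn.trace_riemTensor (hm : IsMetricOn N h) {p : Fr 𝕜} (hp : p ∈ frameDomain N)
    (e b : Fin 3) :
    ∑ f, ∑ a, (frameMetric h p)⁻¹ f a * comp (riemTensor h) ![f, e, a, b] p =
      ∑ m, ∑ n, p.2 b m * p.2 e n * ricci h p.1 m n := by
  have h1 : ∀ m n, ricci h p.1 m n = ∑ c, riem h p.1 c n c m := by
    intro m n
    simp only [ricci, riem, Finset.sum_add_distrib]
  have h2 : ∀ c n q l, riem h p.1 c n q l = ∑ r, (h p.1)⁻¹ c r * riemTensor h p.1 ![r, n, q, l] := by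
    intro c n q l
    have : riem h p.1 c n q l =
        ((h p.1)⁻¹.mulVec ((h p.1).mulVec fun c => riem h p.1 c n q l)) c := by
      rw [Matrix.mulVec_mulVec, Matrix.nonsing_inv_mul _ (hm.nondeg _ hp.1).isUnit,
        Matrix.one_mulVec]
    rw [this]
    rfl
  have hsymm : ∀ c r, (h p.1)⁻¹ c r = (h p.1)⁻¹ r c := by
    intro c r
    have h3 : (h p.1)⁻¹.transpose = (h p.1)⁻¹ := by
      rw [Matrix.transpose_nonsing_inv, (hm.symm _ hp.1).eq]
    exact congrFun (congrFun h3 r) c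
  simp only [comp_four, h1, h2]
  have h4 : ∀ c r, (h p.1)⁻¹ c r = ∑ a, ∑ b, (frameMetric h p)⁻¹ a b * p.2 a r * p.2 b c :=
    fun c r => by rw [hsymm]; exact inv_apply_frame hp r c
  simp only [h4, Finset.mul_sum, Finset.sum_mul]
  calc _ = ∑ f, ∑ a, ∑ r, ∑ n, ∑ c, ∑ m, (frameMetric h p)⁻¹ f a * p.2 f r * p.2 a c *
        p.2 b m * p.2 e n * riemTensor h p.1 ![r, n, c, m] := by
        refine Finset.sum_congr rfl fun _ _ => Finset.sum_congr rfl fun _ _ => ?_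
        refine Finset.sum_congr rfl fun _ _ => Finset.sum_congr rfl fun _ _ => ?_
        exact Finset.sum_congr rfl fun _ _ => Finset.sum_congr rfl fun _ _ => by ring
    _ = ∑ m, ∑ n, ∑ c, ∑ r, ∑ f, ∑ a, (frameMetric h p)⁻¹ f a * p.2 f r * p.2 a c *
        p.2 b m * p.2 e n * riemTensor h p.1 ![r, n, c, m] := by
        have hfa : ∀ G : Fin 3 → Fin 3 → Fin 3 → 𝕜,
            ∑ f, ∑ a, ∑ x, G f a x = ∑ x, ∑ f, ∑ a, G f a x := fun G =>
          (Finset.sum_congr rfl fun f _ => Finset.sum_comm).trans Finset.sum_comm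
        have hrev : ∀ G : Fin 3 → Fin 3 → Fin 3 → 𝕜,
            ∑ f, ∑ a, ∑ x, G f a x = ∑ x, ∑ a, ∑ f, G f a x := fun G =>
          (hfa G).trans (Finset.sum_congr rfl fun f _ => Finset.sum_comm)
        refine (hfa _).trans ((Finset.sum_congr rfl fun r _ => (hfa _).trans
          (Finset.sum_congr rfl fun n _ => (hfa _).trans
          (Finset.sum_congr rfl fun c _ => hfa _))).trans ?_)
        refine Finset.sum_comm.trans (((Finset.sum_congr rfl fun n _ => hrev _)).trans ?_)
        exact Finset.sum_comm
    _ = _ := by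
        refine Finset.sum_congr rfl fun _ _ => Finset.sum_congr rfl fun _ _ => ?_
        refine Finset.sum_congr rfl fun _ _ => Finset.sum_congr rfl fun _ _ => ?_
        exact Finset.sum_congr rfl fun _ _ => Finset.sum_congr rfl fun _ _ => by ring

end FramePair

/-! ### Frame metric and metric traces -/

namespace FramePair

variable {𝕜 : Type*} [RCLike 𝕜] {P : FramePair 𝕜}

/-- Pairs of smooth tensor fields. -/
def SmoothT (P : FramePair 𝕜) {k : ℕ} (T : Bool → TensorField 𝕜 k) : Prop :=
  ∀ b, SmoothTensor (P.N b) (T b)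

/-- The frame components of a pair of tensor fields. -/
def pairComp {k : ℕ} (T : Bool → TensorField 𝕜 k) (I : Fin k → Fin 3) : FunPair 𝕜 :=
  fun b => comp (T b) I

/-- The covariant derivative of a pair of tensor fields. -/
def D (P : FramePair 𝕜) {k : ℕ} (T : Bool → TensorField 𝕜 k) : Bool → TensorField 𝕜 (k + 1) :=
  fun b => covDeriv (P.h b) (T b)

lemma SmoothT.D {k : ℕ} {T : Bool → TensorField 𝕜 k} (hT : P.SmoothT T) : P.SmoothT (P.D T) :=
  fun b => (P.metric b).smooth_covDeriv (hT b)

lemma SmoothT.smooth {k : ℕ} {T : Bool → TensorField 𝕜 k} (hT : P.SmoothT T)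
    (I : Fin k → Fin 3) : P.Smooth (pairComp T I) := fun b => contDiffOn_comp (hT b) I

lemma SmoothT.E_cmp {k : ℕ} {T : Bool → TensorField 𝕜 k} (hT : P.SmoothT T) (a : Fin 3)
    (I : Fin k → Fin 3) : P.EqU (P.E a (pairComp T I)) (pairComp (P.D T) (Fin.cons a I)) := fun b p hp =>
  horDeriv_comp (fun K => ((hT b K).contDiffAt
    ((P.metric b).isOpen.mem_nhds hp.1)).differentiableAt (by simp)) a I

/-- The frame components of the metric. -/
def met (P : FramePair 𝕜) (a b : Fin 3) : FunPair 𝕜 := fun i p => frameMetric (P.h i) p a b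

/-- The frame components of the inverse metric. -/
def ginv (P : FramePair 𝕜) (a b : Fin 3) : FunPair 𝕜 := fun i p => (frameMetric (P.h i) p)⁻¹ a b

lemma met_eq_cmp (a b : Fin 3) :
    P.met a b = pairComp (fun i => metricTensor (P.h i)) ![a, b] := by
  funext i p
  exact (comp_metricTensor (P.h i) p a b).symm

lemma smoothT_metricTensor : P.SmoothT (fun i => metricTensor (P.h i)) :=
  fun i _ => (P.metric i).smooth _ _

lemma smooth_met (a b : Fin 3) : P.Smooth (P.met a b) := by
  rw [met_eq_cmp]
  exact smoothT_metricTensor.smooth _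

lemma smooth_ginv (a b : Fin 3) : P.Smooth (P.ginv a b) := fun i =>
  contDiffOn_inv (fun a b => smooth_met a b i)
    (fun _ hp => (P.metric i).det_frameMetric hp) a b

lemma E_met (c a b : Fin 3) : P.EqU (P.E c (P.met a b)) (fun _ _ => 0) := by
  intro i p hp
  rw [met_eq_cmp, smoothT_metricTensor.E_cmp c _ i hp]
  simp only [pairComp, comp, frameComp]
  refine Finset.sum_eq_zero fun K _ => ?_
  rw [FramePair.D, (P.metric i).covDeriv_metric hp.1, mul_zero]

lemma E_sum {ι : Type*} {s : Finset ι} {f : ι → FunPair 𝕜} (hf : ∀ i ∈ s, P.Smooth (f i))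
    (a : Fin 3) : P.EqU (P.E a (fun b p => ∑ i ∈ s, f i b p))
      (fun b p => ∑ i ∈ s, P.E a (f i) b p) := by
  intro b p hp
  simp only [FramePair.E, horDeriv]
  rw [fderiv_fun_sum fun i hi => (hf i hi).differentiableAt hp]
  simp

lemma ginv_mul_met (a b : Fin 3) :
    P.EqU (fun i p => ∑ c, P.ginv a c i p * P.met c b i p) (fun _ _ => if a = b then 1 else 0) := by
  intro i p hp
  have := Matrix.nonsing_inv_mul _ ((P.metric i).det_frameMetric hp).isUnit
  have := congrFun (congrFun this a) b
  rw [Matrix.mul_apply, Matrix.one_apply] at this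
  exact this

lemma met_mul_ginv (a b : Fin 3) :
    P.EqU (fun i p => ∑ c, P.met a c i p * P.ginv c b i p) (fun _ _ => if a = b then 1 else 0) := by
  intro i p hp
  have := Matrix.mul_nonsing_inv _ ((P.metric i).det_frameMetric hp).isUnit
  have := congrFun (congrFun this a) b
  rw [Matrix.mul_apply, Matrix.one_apply] at this
  exact this

/-- Differentiate the relation between the metric and its inverse, use that the metric is
horizontally constant, and cancel the metric. -/
lemma E_ginv (c a b : Fin 3) : P.EqU (P.E c (P.ginv a b)) (fun _ _ => 0) := by
  intro i p hp
  have h1 : ∀ b, ∑ d, P.E c (P.ginv a d) i p * P.met d b i p = 0 := by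
    intro b
    have h2 := (ginv_mul_met (P := P) a b).E c i hp
    rw [E_const] at h2
    rw [E_sum (f := fun d i p => P.ginv a d i p * P.met d b i p)
      (fun d _ j => (smooth_ginv a d j).mul (smooth_met d b j)) c i hp] at h2
    refine Eq.trans ?_ h2
    refine Finset.sum_congr rfl fun d _ => ?_
    rw [E_mul (smooth_ginv a d) (smooth_met d b) c i hp]
    beta_reduce
    rw [E_met c d b i hp]
    ring
  have h3 : P.E c (P.ginv a b) i p =
      ∑ e, (∑ d, P.E c (P.ginv a d) i p * P.met d e i p) * P.ginv e b i p := by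
    simp only [Finset.sum_mul, mul_assoc]
    rw [Finset.sum_comm]
    simp only [← Finset.mul_sum]
    have h4 := fun d => met_mul_ginv (P := P) d b i hp
    beta_reduce at h4
    simp only [h4]
    simp
  rw [h3]
  simp [h1]

lemma met_pt (i : Bool) (a b : Fin 3) :
    P.met a b i (P.pt i) = if a = b then ((P.sgn : ℤ) : 𝕜) else 0 := by
  simp [met, P.orthonormal i, Matrix.one_apply]

lemma sgn_mul_sgn (s : ℤˣ) : ((s : ℤ) : 𝕜) * ((s : ℤ) : 𝕜) = 1 := by
  rcases Int.units_eq_one_or s with rfl | rfl <;> simp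

lemma ginv_pt (i : Bool) (a b : Fin 3) :
    P.ginv a b i (P.pt i) = if a = b then ((P.sgn : ℤ) : 𝕜) else 0 := by
  have : (frameMetric (P.h i) (P.pt i))⁻¹ = ((P.sgn : ℤ) : 𝕜) • (1 : Matrix (Fin 3) (Fin 3) 𝕜) := by
    apply Matrix.inv_eq_right_inv
    rw [P.orthonormal i]
    simp [smul_smul, sgn_mul_sgn]
  simp [ginv, this, Matrix.one_apply]

lemma matches_met (a b : Fin 3) : P.Matches (P.met a b) := by
  unfold Matches
  rw [met_pt, met_pt]
  split_ifs <;> simp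

lemma matches_ginv (a b : Fin 3) : P.Matches (P.ginv a b) := by
  unfold Matches
  rw [ginv_pt, ginv_pt]
  split_ifs <;> simp

/-- All horizontal derivatives vanish, and at both distinguished frames the value is the same sign
times the Kronecker delta, which every `θ` preserves. -/
lemma agr_met (k : ℕ) (a b : Fin 3) : P.Agr k (P.met a b) :=
  Agr.of_E_eq_zero (smooth_met a b) (matches_met a b) fun c => E_met c a b

lemma agr_ginv (k : ℕ) (a b : Fin 3) : P.Agr k (P.ginv a b) :=
  Agr.of_E_eq_zero (smooth_ginv a b) (matches_ginv a b) fun c => E_ginv c a b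

/-- The trace of a family of pairs of functions with respect to the inverse metric. -/
def tr (P : FramePair 𝕜) (f : Fin 3 → Fin 3 → FunPair 𝕜) : FunPair 𝕜 :=
  fun i p => ∑ a, ∑ b, P.ginv a b i p * f a b i p

lemma EqU.tr {f g : Fin 3 → Fin 3 → FunPair 𝕜} (h : ∀ a b, P.EqU (f a b) (g a b)) :
    P.EqU (P.tr f) (P.tr g) := fun i p hp =>
  Finset.sum_congr rfl fun a _ => Finset.sum_congr rfl fun b _ => by rw [h a b i hp]

lemma E_tr {f : Fin 3 → Fin 3 → FunPair 𝕜} (hf : ∀ a b, P.Smooth (f a b)) (c : Fin 3) :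
    P.EqU (P.E c (P.tr f)) (P.tr fun a b => P.E c (f a b)) := by
  intro i p hp
  have hs : ∀ a b, P.Smooth (fun i p => P.ginv a b i p * f a b i p) := fun a b j =>
    (smooth_ginv a b j).mul (hf a b j)
  unfold FramePair.tr
  rw [E_sum (f := fun a i p => ∑ b, P.ginv a b i p * f a b i p)
    (fun a _ j => ContDiffOn.sum fun b _ => hs a b j) c i hp]
  refine Finset.sum_congr rfl fun a _ => ?_
  rw [E_sum (f := fun b i p => P.ginv a b i p * f a b i p) (fun b _ => hs a b) c i hp]
  refine Finset.sum_congr rfl fun b _ => ?_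
  rw [E_mul (smooth_ginv a b) (hf a b) c i hp]
  beta_reduce
  rw [E_ginv c a b i hp]
  ring

lemma tr_pt (f : Fin 3 → Fin 3 → FunPair 𝕜) (i : Bool) :
    P.tr f i (P.pt i) = ((P.sgn : ℤ) : 𝕜) * ∑ a, f a a i (P.pt i) := by
  simp [FramePair.tr, ginv_pt, Finset.mul_sum]

/-- At an orthonormal frame the metric trace is the plain diagonal sum up to the common sign, whose
square is one. -/
lemma sum_diag_eq_of_matches_tr {f : Fin 3 → Fin 3 → FunPair 𝕜} (h : P.Matches (P.tr f)) :
    ∑ a, (f a a true (P.pt true) - P.θ (f a a false (P.pt false))) = 0 := by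
  unfold Matches at h
  rw [tr_pt, tr_pt, map_mul, map_intCast, map_sum] at h
  rw [Finset.sum_sub_distrib, sub_eq_zero]
  have h2 := congrArg (fun z => ((P.sgn : ℤ) : 𝕜) * z) h
  simpa only [← mul_assoc, sgn_mul_sgn, one_mul] using h2

/-! ### The curvature -/

lemma E_neg (f : FunPair 𝕜) (c : Fin 3) :
    P.E c (fun i p => - f i p) = fun i p => - P.E c f i p := by
  funext i p
  simp only [FramePair.E, horDeriv]
  rw [fderiv_fun_neg]
  rfl

/-- Bivectors in dimension three form a three-dimensional space, so `y` is a matrix with nine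
entries. The nine components of the contraction determine it; neither pair symmetry nor the Bianchi
identity is needed. -/
lemma eq_zero_of_antisymm_of_trace {y : Fin 3 → Fin 3 → Fin 3 → Fin 3 → 𝕜}
    (y1 : ∀ f e a b, y f e a b = - y e f a b) (y2 : ∀ f e a b, y f e a b = - y f e b a)
    (yt : ∀ e b, ∑ f, y f e f b = 0) (f e a b : Fin 3) : y f e a b = 0 := by
  simp only [Fin.sum_univ_three] at yt
  have d1 : ∀ f a b, y f f a b = 0 := fun f a b => by
    have := y1 f f a b; linear_combination (1 / 2) * this
  have d2 : ∀ f e a, y f e a a = 0 := fun f e a => by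
    have := y2 f e a a; linear_combination (1 / 2) * this
  have m1 : ∀ f e a b, y e f b a = y f e a b := fun f e a b => by
    rw [y1 e f, y2 f e b a, neg_neg]
  have q : ∀ f e a b, f < e → a < b → y f e a b = 0 := by
    have t00 := yt 0 0
    have t11 := yt 1 1
    have t22 := yt 2 2
    have t01 := yt 0 1
    have t10 := yt 1 0
    have t02 := yt 0 2
    have t20 := yt 2 0
    have t12 := yt 1 2
    have t21 := yt 2 1
    simp only [d1, d2, zero_add, add_zero] at t00 t11 t22 t01 t10 t02 t20 t12 t21
    have e1 := m1 0 1 0 1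
    have e2 := m1 0 2 0 2
    have e3 := m1 1 2 1 2
    have z1 : y 0 1 0 1 = 0 := by
      linear_combination (1 / 2) * (t00 + t11 - t22 - e1 - e2 - e3)
    have z2 : y 0 2 0 2 = 0 := by
      linear_combination t00 - e1 - e2 - z1
    have z3 : y 1 2 1 2 = 0 := by
      linear_combination t22 - z2
    have z4 : y 0 1 1 2 = 0 := by linear_combination y1 1 0 1 2 - t02
    have z5 : y 1 2 0 1 = 0 := by linear_combination y2 1 2 1 0 - t20
    have z6 : y 0 2 1 2 = 0 := by rw [← m1]; exact t01
    have z7 : y 1 2 0 2 = 0 := by rw [← m1]; exact t10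
    intro f e a b hfe hab
    fin_cases f <;> fin_cases e <;> simp at hfe <;>
      fin_cases a <;> fin_cases b <;> simp at hab <;> simpa
  rcases lt_trichotomy f e with hfe | rfl | hfe
  · rcases lt_trichotomy a b with hab | rfl | hab
    · exact q _ _ _ _ hfe hab
    · exact d2 _ _ _
    · rw [y2, q _ _ _ _ hfe hab, neg_zero]
  · exact d1 _ _ _
  · rw [y1]
    rcases lt_trichotomy a b with hab | rfl | hab
    · rw [q _ _ _ _ hfe hab, neg_zero]
    · rw [d2, neg_zero]
    · rw [y2, q _ _ _ _ hfe hab, neg_zero, neg_zero]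

/-- In dimension three a tensor with the antisymmetries of the Riemann tensor is controlled by
its contraction. -/
lemma agr_of_tr {k : ℕ} {Y : Fin 3 → Fin 3 → Fin 3 → Fin 3 → FunPair 𝕜}
    (hs : ∀ f e a b, P.Smooth (Y f e a b))
    (h1 : ∀ f e a b, P.EqU (Y f e a b) (fun i p => - Y e f a b i p))
    (h2 : ∀ f e a b, P.EqU (Y f e a b) (fun i p => - Y f e b a i p))
    (ht : ∀ e b, P.Agr k (P.tr fun f a => Y f e a b)) (f e a b : Fin 3) :
    P.Agr k (Y f e a b) := by
  induction k generalizing Y f e a b with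
  | zero => exact hs f e a b
  | succ k ih =>
    refine ⟨hs f e a b, ?_, fun c => ?_⟩
    · set y : Fin 3 → Fin 3 → Fin 3 → Fin 3 → 𝕜 := fun f e a b =>
        Y f e a b true (P.pt true) - P.θ (Y f e a b false (P.pt false)) with hy
      have y1 : ∀ f e a b, y f e a b = - y e f a b := by
        intro f e a b
        simp only [hy]
        rw [h1 f e a b true (P.mem true), h1 f e a b false (P.mem false), map_neg]
        ring
      have y2 : ∀ f e a b, y f e a b = - y f e b a := by
        intro f e a b
        simp only [hy]
        rw [h2 f e a b true (P.mem true), h2 f e a b false (P.mem false), map_neg]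
        ring
      have yt : ∀ e b, ∑ f, y f e f b = 0 := fun e b =>
        sum_diag_eq_of_matches_tr (f := fun f a => Y f e a b) (ht e b).matches
      exact sub_eq_zero.1 (eq_zero_of_antisymm_of_trace y1 y2 yt f e a b)
    -- The antisymmetries survive differentiation and the trace commutes with it, so the induction
    -- hypothesis applies to the derivative of `Y`.
    · have hE : ∀ f e a b, P.Smooth (P.E c (Y f e a b)) := fun f e a b => (hs f e a b).E c
      refine ih (Y := fun f e a b => P.E c (Y f e a b)) hE ?_ ?_ ?_ f e a b
      · intro f e a b
        rw [← E_neg]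
        exact (h1 f e a b).E c
      · intro f e a b
        rw [← E_neg]
        exact (h2 f e a b).E c
      · intro e b
        exact ((ht e b).E c).congr (E_tr (fun f a => hs f e a b) c)

/-- The lowered Riemann tensor. -/
def curv (P : FramePair 𝕜) (f e a b : Fin 3) : FunPair 𝕜 :=
  pairComp (fun i => riemTensor (P.h i)) ![f, e, a, b]

lemma smooth_curv (f e a b : Fin 3) : P.Smooth (P.curv f e a b) :=
  SmoothT.smooth (fun i => (P.metric i).smooth_riemTensor) _

lemma E_comm {k : ℕ} {T : Bool → TensorField 𝕜 k} (hT : P.SmoothT T) (a b : Fin 3)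
    (I : Fin k → Fin 3) : P.EqU
      (fun i p => P.E a (P.E b (pairComp T I)) i p - P.E b (P.E a (pairComp T I)) i p)
      (fun i p => - ∑ j, ∑ d, (∑ f, P.ginv d f i p * P.curv f (I j) a b i p) *
        pairComp T (Function.update I j d) i p) := fun i _ hp =>
  (P.metric i).horDeriv_comm_comp hp (hT i) a b I

/-- The Ricci identity applied to the metric, whose covariant derivatives vanish. -/
lemma curv_antisymm (f e a b : Fin 3) :
    P.EqU (P.curv f e a b) (fun i p => - P.curv e f a b i p) := by
  intro i p hp
  have h1 := E_comm (P := P) smoothT_metricTensor a b ![f, e] i hp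
  have h2 : ∀ a b, P.E a (P.E b (pairComp (fun i => metricTensor (P.h i)) ![f, e])) i p = 0 := by
    intro a b
    rw [← met_eq_cmp, (E_met b f e).E a i hp, E_const]
  beta_reduce at h1
  rw [h2, h2] at h1
  have u0 : ∀ d : Fin 3, Function.update ![f, e] 0 d = ![d, e] := fun d => by
    funext j; fin_cases j <;> rfl
  have u1 : ∀ d : Fin 3, Function.update ![f, e] 1 d = ![f, d] := fun d => by
    funext j; fin_cases j <;> rfl
  rw [Fin.sum_univ_two] at h1
  simp only [u0, u1, ← met_eq_cmp, Matrix.cons_val_zero, Matrix.cons_val_one] at h1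
  have h3 : ∀ g, ∑ d, (∑ c, P.ginv d c i p * P.curv c g a b i p) * P.met f d i p =
      P.curv f g a b i p := by
    intro g
    simp only [Finset.sum_mul]
    rw [Finset.sum_comm]
    have h4 : ∀ c, ∑ d, P.met f d i p * P.ginv d c i p = if f = c then 1 else 0 := fun c =>
      met_mul_ginv f c i hp
    have h5 : ∀ c, ∑ d, P.ginv d c i p * P.curv c g a b i p * P.met f d i p =
        (if f = c then 1 else 0) * P.curv c g a b i p := fun c => by
      rw [← h4, Finset.sum_mul]
      exact Finset.sum_congr rfl fun d _ => by ring
    simp [h5]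
  have h6 : ∀ g, ∑ d, (∑ c, P.ginv d c i p * P.curv c g a b i p) * P.met d e i p =
      P.curv e g a b i p := by
    intro g
    simp only [Finset.sum_mul]
    rw [Finset.sum_comm]
    have h4 : ∀ c, ∑ d, P.met e d i p * P.ginv d c i p = if e = c then 1 else 0 := fun c =>
      met_mul_ginv e c i hp
    have h5 : ∀ c, ∑ d, P.ginv d c i p * P.curv c g a b i p * P.met d e i p =
        (if e = c then 1 else 0) * P.curv c g a b i p := fun c => by
      rw [← h4, Finset.sum_mul]
      refine Finset.sum_congr rfl fun d _ => ?_
      rw [show P.met d e i p = P.met e d i p from (P.metric i).frameMetric_symm hp d e]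
      ring
    simp [h5]
  rw [h3, h6] at h1
  linear_combination h1

/-- The frame components of the Ricci tensor. -/
def ric (P : FramePair 𝕜) (a b : Fin 3) : FunPair 𝕜 := fun i p =>
  ∑ m, ∑ n, p.2 a m * p.2 b n * ricci (P.h i) p.1 m n

lemma agr_curv {k : ℕ} (hr : ∀ a b, P.Agr k (P.ric a b)) (f e a b : Fin 3) :
    P.Agr k (P.curv f e a b) := by
  refine agr_of_tr smooth_curv curv_antisymm ?_ ?_ f e a b
  · exact fun f e a b i p _ => riemTensor_antisymm (P.h i) f e a b p
  · exact fun e b => (hr b e).congr fun i p hp => ((P.metric i).trace_riemTensor hp e b).symm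

/-! ### Towers of covariant derivatives -/

/-- Agreement of all the frame components. -/
def AgrT (P : FramePair 𝕜) (k : ℕ) {m : ℕ} (T : Bool → TensorField 𝕜 m) : Prop :=
  ∀ I, P.Agr k (pairComp T I)

/-- Symmetry up to agreement. -/
def SymAgr (P : FramePair 𝕜) (k : ℕ) {m : ℕ} (T : Bool → TensorField 𝕜 m) : Prop :=
  ∀ (σ : Equiv.Perm (Fin m)) I, P.Agr k (fun i p => pairComp T (I ∘ σ) i p - pairComp T I i p)

/-- Some trace vanishes up to agreement. -/
def TrAgr (P : FramePair 𝕜) (k : ℕ) {m : ℕ} (T : Bool → TensorField 𝕜 m) : Prop :=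
  ∃ j l : Fin m, j ≠ l ∧ ∀ I,
    P.Agr k (P.tr fun a b => pairComp T (Function.update (Function.update I j a) l b))

variable {m k : ℕ} {T : Bool → TensorField 𝕜 m}

lemma AgrT.D (hT : P.SmoothT T) (h : P.AgrT (k + 1) T) : P.AgrT k (P.D T) := by
  intro I
  rw [← Fin.cons_self_tail I]
  exact ((h (Fin.tail I)).E (I 0)).congr (hT.E_cmp _ _)

/-- The basic way to gain one order: matching values together with agreement of the covariant
derivative. -/
lemma AgrT.of_D (hT : P.SmoothT T) (h0 : ∀ I, P.Matches (pairComp T I)) (h : P.AgrT k (P.D T)) :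
    P.AgrT (k + 1) T := fun I =>
  (hT.smooth I).agr_succ (h0 I) fun a => (h (Fin.cons a I)).congr (hT.E_cmp a I).symm

lemma TrAgr.D (hT : P.SmoothT T) (h : P.TrAgr (k + 1) T) : P.TrAgr k (P.D T) := by
  obtain ⟨j, l, hjl, h⟩ := h
  refine ⟨j.succ, l.succ, fun e => hjl (Fin.succ_injective _ e), fun I => ?_⟩
  rw [← Fin.cons_self_tail I]
  simp only [← Fin.cons_update]
  refine ((h (Fin.tail I)).E (I 0)).congr fun i p hp => ?_
  rw [E_tr (fun a b => hT.smooth _) (I 0) i hp]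
  exact EqU.tr (fun a b => hT.E_cmp _ _) i hp

lemma E_sub {f g : FunPair 𝕜} (hf : P.Smooth f) (hg : P.Smooth g) (a : Fin 3) :
    P.EqU (P.E a (fun b p => f b p - g b p)) (fun b p => P.E a f b p - P.E a g b p) := by
  intro b p hp
  simp only [FramePair.E, horDeriv]
  rw [fderiv_fun_sub (hf.differentiableAt hp) (hg.differentiableAt hp)]
  rfl

/-- Adjacent transpositions generate the symmetric group, and discrepancies add up along a product.
-/
lemma SymAgr.of_swap {n : ℕ} {T : Bool → TensorField 𝕜 (n + 1)}
    (h : ∀ (j : Fin n) I, P.Agr k (fun i p =>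
      pairComp T (I ∘ Equiv.swap j.castSucc j.succ) i p - pairComp T I i p)) : P.SymAgr k T := by
  intro σ
  have hσ : σ ∈ Submonoid.closure
      (Set.range fun j : Fin n => Equiv.swap j.castSucc j.succ) := by
    rw [Equiv.Perm.mclosure_swap_castSucc_succ]; trivial
  induction hσ using Submonoid.closure_induction with
  | mem σ hσ => obtain ⟨j, rfl⟩ := hσ; exact h j
  | one =>
    intro I
    exact (Agr.const (r := 0) (map_zero _)).congr fun i p _ => by simp
  | mul σ τ _ _ h1 h2 =>
    intro I
    refine ((h1 I).add (h2 (I ∘ σ))).congr fun i p _ => ?_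
    simp [Function.comp_assoc]

/-- Exchanges among the old slots are inherited from `T` by differentiation. The only new one moves
the derivative index past the first old slot, and `h0` supplies it. -/
lemma SymAgr.D {n : ℕ} {T : Bool → TensorField 𝕜 (n + 1)} (hT : P.SmoothT T)
    (h : P.SymAgr (k + 1) T)
    (h0 : ∀ a b (I : Fin n → Fin 3), P.Agr k (fun i p => pairComp (P.D T) (Fin.cons a (Fin.cons b I)) i p -
      pairComp (P.D T) (Fin.cons b (Fin.cons a I)) i p)) : P.SymAgr k (P.D T) := by
  refine SymAgr.of_swap fun j I => ?_
  refine Fin.cases ?_ (fun j => ?_) j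
  · rw [← Fin.cons_self_tail I, ← Fin.cons_self_tail (Fin.tail I)]
    have : (Fin.cons (I 0) (Fin.cons (Fin.tail I 0) (Fin.tail (Fin.tail I))) : Fin (n + 2) → Fin 3) ∘
        Equiv.swap (Fin.castSucc 0) (Fin.succ 0) =
        Fin.cons (Fin.tail I 0) (Fin.cons (I 0) (Fin.tail (Fin.tail I))) := by
      funext l
      refine Fin.cases ?_ (fun l => ?_) l
      · simp [Fin.tail]
      · refine Fin.cases ?_ (fun l => ?_) l
        · simp
        · rw [Function.comp, Equiv.swap_apply_of_ne_of_ne]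
          · simp [Fin.tail]
          · simp
          · simp [Fin.ext_iff]
    rw [this]
    exact h0 _ _ _
  · rw [← Fin.cons_self_tail I]
    have : (Fin.cons (I 0) (Fin.tail I) : Fin (n + 2) → Fin 3) ∘
        Equiv.swap (Fin.castSucc j.succ) (Fin.succ j.succ) =
        Fin.cons (I 0) (Fin.tail I ∘ Equiv.swap j.castSucc j.succ) := by
      funext l
      refine Fin.cases ?_ (fun l => ?_) l
      · rw [Function.comp, Equiv.swap_apply_of_ne_of_ne]
        · simp
        · simp [Fin.ext_iff]
        · simp [Fin.ext_iff]
      · simp only [Function.comp, Fin.castSucc_succ, Fin.cons_succ]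
        rw [← Function.Injective.map_swap (Fin.succ_injective _)]
        simp
    rw [this]
    refine ((h (Equiv.swap j.castSucc j.succ) (Fin.tail I)).E (I 0)).congr fun i p hp => ?_
    rw [E_sub (hT.smooth _) (hT.smooth _) (I 0) i hp]
    beta_reduce
    rw [hT.E_cmp _ _ i hp, hT.E_cmp _ _ i hp]

/-- By the Ricci identity the two outermost derivatives commute up to curvature times `T`, so
agreement of `T` and of the Ricci tensor to the same order suffices. -/
lemma agr_D_D_comm (hT : P.SmoothT T) (hA : P.AgrT k T)
    (hr : ∀ a b, P.Agr k (P.ric a b)) (a b : Fin 3) (I : Fin m → Fin 3) :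
    P.Agr k (fun i p => pairComp (P.D (P.D T)) (Fin.cons a (Fin.cons b I)) i p -
      pairComp (P.D (P.D T)) (Fin.cons b (Fin.cons a I)) i p) := by
  have h1 : P.Agr k (fun i p => - ∑ j, ∑ d, (∑ f, P.ginv d f i p * P.curv f (I j) a b i p) *
        pairComp T (Function.update I j d) i p) :=
    (Agr.sum fun j _ => Agr.sum fun d _ =>
      (Agr.sum fun f _ => (agr_ginv k d f).mul (agr_curv hr f (I j) a b)).mul (hA _)).neg
  refine h1.congr fun i p hp => ?_
  rw [← E_comm hT a b I i hp]
  beta_reduce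
  have h2 : ∀ a b, P.E a (P.E b (pairComp T I)) i p =
      pairComp (P.D (P.D T)) (Fin.cons a (Fin.cons b I)) i p := fun a b => by
    rw [(hT.E_cmp b I).E a i hp, hT.D.E_cmp a _ i hp]
  rw [h2, h2]

lemma exists_perm_pair {n : ℕ} {j l j' l' : Fin n} (h : j ≠ l) (h' : j' ≠ l') :
    ∃ σ : Equiv.Perm (Fin n), σ j = j' ∧ σ l = l' := by
  refine ⟨(Equiv.swap j j').trans (Equiv.swap (Equiv.swap j j' l) l'), ?_, ?_⟩
  · simp only [Equiv.trans_apply, Equiv.swap_apply_left]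
    refine Equiv.swap_apply_of_ne_of_ne (fun e => ?_) h'
    have := congrArg (Equiv.swap j j') e
    simp at this
    exact h this
  · simp

/-- Symmetric tensors with vanishing trace agree if their null data do. -/
lemma matches_of_symmetrize (hs : P.SymAgr 1 T) (ht : (∀ j l : Fin m, j ≠ l → P.TrAgr 1 T))
    (h0 : symmetrize (toSpinor fun I => pairComp T I true (P.pt true)) =
      symmetrize (toSpinor fun I => P.θ (pairComp T I false (P.pt false)))) (I : Fin m → Fin 3) :
    P.Matches (pairComp T I) := by
  set X : (Fin m → Fin 3) → 𝕜 := fun I =>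
    pairComp T I true (P.pt true) - P.θ (pairComp T I false (P.pt false)) with hX
  have hsym : ∀ (σ : Equiv.Perm (Fin m)) I, X (I ∘ σ) = X I := by
    intro σ I
    have := (hs σ I).matches
    unfold Matches at this
    rw [map_sub] at this
    simp only [hX]
    linear_combination this
  have hX0 : X = 0 := by
    refine eq_zero_of_symmetrize_toSpinor hsym (fun j l hjl I => ?_) ?_
    -- `h` controls the trace over one pair of slots; a permutation carrying that pair to `j`, `l`
    -- transfers it, since `X` is symmetric.
    · obtain ⟨j', l', hjl', h⟩ := ht j l hjl
      obtain ⟨σ, hσj, hσl⟩ := exists_perm_pair hjl' hjl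
      have h1 := sum_diag_eq_of_matches_tr (h (I ∘ σ)).matches
      rw [← h1]
      refine Finset.sum_congr rfl fun a _ => ?_
      rw [← hsym σ]
      simp only [hX]
      have : Function.update (Function.update I j a) l a ∘ σ =
          Function.update (Function.update (I ∘ σ) j' a) l' a := by
        rw [← hσj, ← hσl]
        funext x
        simp [Function.update_apply]
      rw [this]
    · rw [hX, toSpinor_sub, symmetrize_sub, h0]
      funext A
      simp
  exact sub_eq_zero.1 (congrFun hX0 I)

end FramePair

/-! ### Covariance of the right-hand sides under passage to a frame -/

section Transformation

variable {𝕜 : Type*} [RCLike 𝕜] {N : Set (Pt 𝕜)} {h : Pt 𝕜 → Matrix (Fin 3) (Fin 3) 𝕜}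

/-- The components of a covector in a frame. -/
def frameCovec (c : Fin 3 → Fin 3 → 𝕜) (u : Fin 3 → 𝕜) (a : Fin 3) : 𝕜 := ∑ m, c a m * u m

/-- The components of a bilinear form in a frame. -/
def frameBilin (c : Fin 3 → Fin 3 → 𝕜) (M : Fin 3 → Fin 3 → 𝕜) (a b : Fin 3) : 𝕜 :=
  ∑ m, ∑ n, c a m * c b n * M m n

lemma sum_inv_mul_frame {p : Fr 𝕜} (hp : p ∈ frameDomain N) (M : Fin 3 → Fin 3 → 𝕜) :
    ∑ m, ∑ n, (h p.1)⁻¹ m n * M m n =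
      ∑ a, ∑ b, (frameMetric h p)⁻¹ a b * frameBilin p.2 M a b := by
  simp only [inv_apply_frame hp, frameBilin]
  generalize (frameMetric h p)⁻¹ = g
  simp only [Fin.sum_univ_three]
  ring

lemma ip_frame {p : Fr 𝕜} (hp : p ∈ frameDomain N) (u v : Fin 3 → 𝕜) :
    ip (h p.1)⁻¹ u v = ip (frameMetric h p)⁻¹ (frameCovec p.2 u) (frameCovec p.2 v) := by
  have := sum_inv_mul_frame (h := h) hp fun m n => u m * v n
  simp only [ip, mul_assoc] at this ⊢
  rw [this]
  refine Finset.sum_congr rfl fun a _ => Finset.sum_congr rfl fun b _ => ?_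
  simp only [frameBilin, frameCovec, Finset.sum_mul, Finset.mul_sum]
  rw [Finset.sum_comm]
  exact Finset.sum_congr rfl fun m _ => Finset.sum_congr rfl fun n _ => by ring

lemma ip_comm_sum (g : Matrix (Fin 3) (Fin 3) 𝕜) (k : Fin 3 → 𝕜) (u : Fin 3 → 𝕜)
    (w : Fin 3 → Fin 3 → 𝕜) :
    ip g u (fun b => ∑ m, k m * w m b) = ∑ m, k m * ip g u (w m) := by
  simp only [ip, Fin.sum_univ_three]
  ring

lemma ip_comm_sum_left (g : Matrix (Fin 3) (Fin 3) 𝕜) (k : Fin 3 → 𝕜) (u : Fin 3 → 𝕜)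
    (w : Fin 3 → Fin 3 → 𝕜) :
    ip g (fun b => ∑ m, k m * w m b) u = ∑ m, k m * ip g (w m) u := by
  simp only [ip, Fin.sum_univ_three]
  ring

lemma sum_ip_frame {p : Fr 𝕜} (hp : p ∈ frameDomain N) (u : Fin 3 → 𝕜) (M : Fin 3 → Fin 3 → 𝕜)
    (a : Fin 3) :
    ip (frameMetric h p)⁻¹ (frameCovec p.2 u) (fun b => frameBilin p.2 M b a) =
      ∑ m, p.2 a m * ip (h p.1)⁻¹ u (fun b => M b m) := by
  have : (fun b => frameBilin p.2 M b a) =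
      fun b => ∑ m, p.2 a m * frameCovec p.2 (fun b => M b m) b := by
    funext b
    simp only [frameBilin, frameCovec, Finset.mul_sum]
    rw [Finset.sum_comm]
    exact Finset.sum_congr rfl fun m _ => Finset.sum_congr rfl fun n _ => by ring
  rw [this, ip_comm_sum]
  exact Finset.sum_congr rfl fun m _ => by rw [ip_frame hp]

lemma sum_ip_frame_left {p : Fr 𝕜} (hp : p ∈ frameDomain N) (u : Fin 3 → 𝕜)
    (M : Fin 3 → Fin 3 → 𝕜) (a : Fin 3) :
    ip (frameMetric h p)⁻¹ (fun b => frameBilin p.2 M a b) (frameCovec p.2 u) =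
      ∑ m, p.2 a m * ip (h p.1)⁻¹ (fun b => M m b) u := by
  have : (fun b => frameBilin p.2 M a b) =
      fun b => ∑ m, p.2 a m * frameCovec p.2 (fun b => M m b) b := by
    funext b
    simp only [frameBilin, frameCovec, Finset.mul_sum]
    exact Finset.sum_congr rfl fun m _ => Finset.sum_congr rfl fun n _ => by ring
  rw [this, ip_comm_sum_left]
  exact Finset.sum_congr rfl fun m _ => by rw [ip_frame hp]

lemma rhsLaplace_frame {p : Fr 𝕜} (hp : p ∈ frameDomain N) (φ Ω R : 𝕜) (u v : Fin 3 → 𝕜) :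
    rhsLaplace (h p.1)⁻¹ φ Ω R u v =
      rhsLaplace (frameMetric h p)⁻¹ φ Ω R (frameCovec p.2 u) (frameCovec p.2 v) := by
  simp only [rhsLaplace, ip_frame hp]

lemma rhsHessOmega_frame {p : Fr 𝕜} (hp : p ∈ frameDomain N) (φ Ω R : 𝕜)
    (S : Fin 3 → Fin 3 → 𝕜) (u v : Fin 3 → 𝕜) (a b : Fin 3) :
    frameBilin p.2 (rhsHessOmega (h p.1) (h p.1)⁻¹ φ Ω R S u v) a b =
      rhsHessOmega (frameMetric h p) (frameMetric h p)⁻¹ φ Ω R (frameBilin p.2 S)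
        (frameCovec p.2 u) (frameCovec p.2 v) a b := by
  simp only [frameBilin, rhsHessOmega, ← ip_frame hp]
  generalize ip (h p.1)⁻¹ u u = x1
  generalize ip (h p.1)⁻¹ v u = x2
  generalize ip (h p.1)⁻¹ v v = x3
  generalize 1 / (1 + Ω - φ ^ 2) = q
  simp only [frameMetric_apply, frameCovec, Fin.sum_univ_three]
  ring

lemma rhsGradR_frame {p : Fr 𝕜} (hp : p ∈ frameDomain N) (φ Ω R : 𝕜)
    (S : Fin 3 → Fin 3 → 𝕜) (u v : Fin 3 → 𝕜) (H : Fin 3 → Fin 3 → 𝕜) (a : Fin 3) :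
    frameCovec p.2 (rhsGradR (h p.1)⁻¹ φ Ω R S u v H) a =
      rhsGradR (frameMetric h p)⁻¹ φ Ω R (frameBilin p.2 S)
        (frameCovec p.2 u) (frameCovec p.2 v) (frameBilin p.2 H) a := by
  simp only [rhsGradR, sum_ip_frame hp, ← ip_frame hp, frameCovec]
  generalize 1 / (1 + Ω - φ ^ 2) = q
  generalize 1 / (3 * (1 + Ω - φ ^ 2) ^ 2) = r
  simp only [Fin.sum_univ_three]
  ring

/-- Contraction of a tensor of rank three with three vectors. -/
def contr (x y z : Fin 3 → 𝕜) (G : Fin 3 → Fin 3 → Fin 3 → 𝕜) : 𝕜 :=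
  ∑ a, ∑ b, ∑ c, x a * (y b * z c) * G a b c

lemma contr_add (x y z : Fin 3 → 𝕜) (G G' : Fin 3 → Fin 3 → Fin 3 → 𝕜) :
    contr x y z (fun a b c => G a b c + G' a b c) = contr x y z G + contr x y z G' := by
  simp only [contr, mul_add, Finset.sum_add_distrib]

lemma contr_sub (x y z : Fin 3 → 𝕜) (G G' : Fin 3 → Fin 3 → Fin 3 → 𝕜) :
    contr x y z (fun a b c => G a b c - G' a b c) = contr x y z G - contr x y z G' := by
  simp only [contr, mul_sub, Finset.sum_sub_distrib]

lemma contr_const_mul (x y z : Fin 3 → 𝕜) (k : 𝕜) (G : Fin 3 → Fin 3 → Fin 3 → 𝕜) :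
    contr x y z (fun a b c => k * G a b c) = k * contr x y z G := by
  simp only [contr, Finset.mul_sum]
  exact Finset.sum_congr rfl fun _ _ => Finset.sum_congr rfl fun _ _ =>
    Finset.sum_congr rfl fun _ _ => by ring

lemma contr_mul_const (x y z : Fin 3 → 𝕜) (k : 𝕜) (G : Fin 3 → Fin 3 → Fin 3 → 𝕜) :
    contr x y z (fun a b c => G a b c * k) = contr x y z G * k := by
  simp only [mul_comm _ k, contr_const_mul]

lemma contr_alt (e : Fin 3 → Fin 3 → 𝕜) (M : Fin 3 → Fin 3 → 𝕜) (w : Fin 3 → 𝕜) (a b c : Fin 3) :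
    contr (e a) (e b) (e c) (fun a b c => alt (fun b c => M a b * w c) b c) =
      alt (fun b c => frameBilin e M a b * frameCovec e w c) b c := by
  simp only [contr, alt, frameBilin, frameCovec, Fin.sum_univ_three]
  ring

lemma contr_alt_metric (p : Fr 𝕜) (w : Fin 3 → 𝕜) (a b c : Fin 3) :
    contr (p.2 a) (p.2 b) (p.2 c) (fun a b c => alt (fun b c => h p.1 a b * w c) b c) =
      alt (fun b c => frameMetric h p a b * frameCovec p.2 w c) b c := by
  simp only [alt, frameMetric_apply]
  exact contr_alt p.2 (fun a b => h p.1 a b) w a b c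

lemma contr_alt' (e : Fin 3 → Fin 3 → 𝕜) (k : 𝕜) (t u w : Fin 3 → 𝕜) (a b c : Fin 3) :
    contr (e a) (e b) (e c) (fun a b c => k * t a * alt (fun b c => u b * w c) b c) =
      k * frameCovec e t a * alt (fun b c => frameCovec e u b * frameCovec e w c) b c := by
  simp only [contr, alt, frameCovec, Fin.sum_univ_three]
  ring

/-- Linearity of `contr` splits the expression into its antisymmetrized building blocks, each of
which transforms separately. -/
lemma rhsCurlS_frame {p : Fr 𝕜} (hp : p ∈ frameDomain N) (φ Ω R : 𝕜)
    (S : Fin 3 → Fin 3 → 𝕜) (u v : Fin 3 → 𝕜) (H : Fin 3 → Fin 3 → 𝕜) (a b c : Fin 3) :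
    contr (p.2 a) (p.2 b) (p.2 c) (rhsCurlS (h p.1) (h p.1)⁻¹ φ Ω R S u v H) =
      rhsCurlS (frameMetric h p) (frameMetric h p)⁻¹ φ Ω R (frameBilin p.2 S)
        (frameCovec p.2 u) (frameCovec p.2 v) (frameBilin p.2 H) a b c := by
  change contr (p.2 a) (p.2 b) (p.2 c)
    (fun a b c => rhsCurlS (h p.1) (h p.1)⁻¹ φ Ω R S u v H a b c) = _
  simp only [rhsCurlS, sum_ip_frame_left hp, ← ip_frame hp]
  simp only [contr_add, contr_sub, contr_const_mul, contr_mul_const]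
  simp only [contr_alt', contr_alt, contr_alt_metric]
  simp only [frameCovec]

end Transformation

/-! ### Agreement of the right-hand sides -/

namespace FramePair

variable {𝕜 : Type*} [RCLike 𝕜] {P : FramePair 𝕜} {k : ℕ}

lemma θ_ofNat (n : ℕ) [n.AtLeastTwo] :
    P.θ (no_index (OfNat.ofNat n)) = OfNat.ofNat n := map_ofNat P.θ n

lemma agr_frameMetric (k : ℕ) (a b : Fin 3) :
    P.Agr k (fun i p => frameMetric (P.h i) p a b) := agr_met k a b

lemma Agr.ip {u v : Fin 3 → FunPair 𝕜} (hu : ∀ a, P.Agr k (u a)) (hv : ∀ a, P.Agr k (v a)) :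
    P.Agr k (fun i p => ip (frameMetric (P.h i) p)⁻¹ (fun a => u a i p) (fun a => v a i p)) :=
  Agr.sum fun a _ => Agr.sum fun b _ => ((agr_ginv k a b).mul (hu a)).mul (hv b)

section RightHandSides

variable {φ Ω R : FunPair 𝕜} {S H : Fin 3 → Fin 3 → FunPair 𝕜} {u v : Fin 3 → FunPair 𝕜}

/-- The right-hand side is rational in the fields, with the non-vanishing denominator `1 + Ω - φ ^
2`, so the closure rules for `Agr` apply. The three lemmas that follow have the same reason. -/
lemma agr_rhsLaplace (hφ : P.Agr k φ) (hΩ : P.Agr k Ω) (hR : P.Agr k R)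
    (hu : ∀ a, P.Agr k (u a)) (hv : ∀ a, P.Agr k (v a))
    (hQ : ∀ i, ∀ p ∈ P.U i, 1 + Ω i p - φ i p ^ 2 ≠ 0) :
    P.Agr k (fun i p => rhsLaplace (frameMetric (P.h i) p)⁻¹ (φ i p) (Ω i p) (R i p)
      (fun a => u a i p) (fun a => v a i p)) := by
  have h1 := Agr.ip hu hu
  have h2 := Agr.ip hv hu
  have h3 := Agr.ip hv hv
  have h4 : P.Agr k (fun i p => 5 / (1 + Ω i p - φ i p ^ 2)) :=
    (Agr.const (map_ofNat _ _)).div (((Agr.const (map_one _)).add hΩ).sub (hφ.pow 2)) hQ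
  unfold rhsLaplace
  repeat' first | exact Agr.const (by simp [θ_ofNat]) | with_reducible first
    | exact hφ | exact hΩ | exact hR | exact hu _ | exact hv _
    | exact h1 | exact h2 | exact h3 | exact h4
    | apply Agr.add | apply Agr.sub | apply Agr.mul | apply Agr.neg | apply Agr.pow

lemma agr_rhsHessOmega (hφ : P.Agr k φ) (hΩ : P.Agr k Ω) (hR : P.Agr k R)
    (hS : ∀ a b, P.Agr k (S a b)) (hu : ∀ a, P.Agr k (u a)) (hv : ∀ a, P.Agr k (v a))
    (hQ : ∀ i, ∀ p ∈ P.U i, 1 + Ω i p - φ i p ^ 2 ≠ 0) (a b : Fin 3) :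
    P.Agr k (fun i p => rhsHessOmega (frameMetric (P.h i) p) (frameMetric (P.h i) p)⁻¹
      (φ i p) (Ω i p) (R i p) (fun a b => S a b i p) (fun a => u a i p) (fun a => v a i p)
      a b) := by
  have h1 := Agr.ip hu hu
  have h2 := Agr.ip hv hu
  have h3 := Agr.ip hv hv
  have h4 : P.Agr k (fun i p => 1 / (1 + Ω i p - φ i p ^ 2)) :=
    (Agr.const (map_one _)).div (((Agr.const (map_one _)).add hΩ).sub (hφ.pow 2)) hQ
  have h5 := agr_frameMetric (P := P) k a b
  unfold rhsHessOmega
  repeat' first | exact Agr.const (by simp [θ_ofNat]) | with_reducible first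
    | exact hφ | exact hΩ | exact hR | exact hu _ | exact hv _ | exact hS _ _
    | exact h1 | exact h2 | exact h3 | exact h4 | exact h5
    | apply Agr.add | apply Agr.sub | apply Agr.mul | apply Agr.neg | apply Agr.pow

lemma agr_rhsGradR (hφ : P.Agr k φ) (hΩ : P.Agr k Ω) (hR : P.Agr k R)
    (hS : ∀ a b, P.Agr k (S a b)) (hu : ∀ a, P.Agr k (u a)) (hv : ∀ a, P.Agr k (v a))
    (hH : ∀ a b, P.Agr k (H a b))
    (hQ : ∀ i, ∀ p ∈ P.U i, 1 + Ω i p - φ i p ^ 2 ≠ 0) (a : Fin 3) :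
    P.Agr k (fun i p => rhsGradR (frameMetric (P.h i) p)⁻¹
      (φ i p) (Ω i p) (R i p) (fun a b => S a b i p) (fun a => u a i p) (fun a => v a i p)
      (fun a b => H a b i p) a) := by
  have h1 := Agr.ip hu hu
  have h2 := Agr.ip hv hu
  have h3 := Agr.ip hv hv
  have h6 := Agr.ip hv (fun b => hH b a)
  have h7 := Agr.ip hu (fun b => hH b a)
  have h8 := Agr.ip hv (fun b => hS b a)
  have h9 := Agr.ip hu (fun b => hS b a)
  have hq := ((Agr.const (map_one P.θ)).add hΩ).sub (hφ.pow 2)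
  have h4 : P.Agr k (fun i p => 1 / (1 + Ω i p - φ i p ^ 2)) :=
    (Agr.const (map_one _)).div hq hQ
  have h5 : P.Agr k (fun i p => 1 / (3 * (1 + Ω i p - φ i p ^ 2) ^ 2)) :=
    (Agr.const (map_one _)).div ((Agr.const (map_ofNat _ _)).mul (hq.pow 2))
      fun i p hp => mul_ne_zero (by norm_num) (pow_ne_zero _ (hQ i p hp))
  unfold rhsGradR
  repeat' first | exact Agr.const (by simp [θ_ofNat]) | with_reducible first
    | exact hφ | exact hΩ | exact hR | exact hu _ | exact hv _ | exact hS _ _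
    | exact h1 | exact h2 | exact h3 | exact h4 | exact h5
    | exact h6 | exact h7 | exact h8 | exact h9
    | apply Agr.add | apply Agr.sub | apply Agr.mul | apply Agr.neg | apply Agr.pow

lemma agr_rhsCurlS (hφ : P.Agr k φ) (hΩ : P.Agr k Ω) (hR : P.Agr k R)
    (hS : ∀ a b, P.Agr k (S a b)) (hu : ∀ a, P.Agr k (u a)) (hv : ∀ a, P.Agr k (v a))
    (hH : ∀ a b, P.Agr k (H a b))
    (hQ : ∀ i, ∀ p ∈ P.U i, 1 + Ω i p - φ i p ^ 2 ≠ 0) (a b c : Fin 3) :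
    P.Agr k (fun i p => rhsCurlS (frameMetric (P.h i) p) (frameMetric (P.h i) p)⁻¹
      (φ i p) (Ω i p) (R i p) (fun a b => S a b i p) (fun a => u a i p) (fun a => v a i p)
      (fun a b => H a b i p) a b c) := by
  have h1 := Agr.ip hu hu
  have h2 := Agr.ip hv hu
  have h3 := Agr.ip hv hv
  have h6 := fun c => Agr.ip (hH c) hv
  have h7 := fun c => Agr.ip (hH c) hu
  have h8 := fun c => Agr.ip (hS c) hv
  have h9 := fun c => Agr.ip (hS c) hu
  have hq := ((Agr.const (map_one P.θ)).add hΩ).sub (hφ.pow 2)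
  have h4 : P.Agr k (fun i p => 1 / (1 + Ω i p - φ i p ^ 2)) :=
    (Agr.const (map_one _)).div hq hQ
  have h5 : P.Agr k (fun i p => 1 / (9 * (1 + Ω i p - φ i p ^ 2) ^ 2)) :=
    (Agr.const (map_one _)).div ((Agr.const (map_ofNat _ _)).mul (hq.pow 2))
      fun i p hp => mul_ne_zero (by norm_num) (pow_ne_zero _ (hQ i p hp))
  have h10 := agr_frameMetric (P := P) k
  unfold rhsCurlS alt
  repeat' first | exact Agr.const (by simp [θ_ofNat]) | with_reducible first
    | exact hφ | exact hΩ | exact hR | exact hu _ | exact hv _ | exact hS _ _ | exact hH _ _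
    | exact h1 | exact h2 | exact h3 | exact h4 | exact h5
    | exact h6 _ | exact h7 _ | exact h8 _ | exact h9 _ | exact h10 _ _
    | apply Agr.add | apply Agr.sub | apply Agr.mul | apply Agr.neg | apply Agr.pow

end RightHandSides

end FramePair

/-! ### Orders, symmetry and traces along towers of derivatives -/

namespace FramePair

variable {𝕜 : Type*} [RCLike 𝕜] {P : FramePair 𝕜}

lemma tower_down {r : ℕ → ℕ} {T : ∀ q, Bool → TensorField 𝕜 (r q)}
    (hd : ∀ q j, P.AgrT (j + 1) (T q) → P.AgrT j (T (q + 1))) {n : ℕ} (h : P.AgrT n (T 0)) :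
    ∀ q j, q + j = n → P.AgrT j (T q) := by
  intro q
  induction q with
  | zero => intro j hj; rw [zero_add] at hj; subst hj; exact h
  | succ q ih => intro j hj; exact hd q j (ih (j + 1) (by omega))

/-- Agreement of the bottom to order `n` matches all derivatives below order `n`. Matching the
`n`-th ones as well, agreement is rebuilt downwards from level `n`, gaining one order. -/
lemma tower_up {r : ℕ → ℕ} {T : ∀ q, Bool → TensorField 𝕜 (r q)}
    (hd : ∀ q j, P.AgrT (j + 1) (T q) → P.AgrT j (T (q + 1)))
    (hu : ∀ q j, (∀ I, P.Matches (pairComp (T q) I)) → P.AgrT j (T (q + 1)) → P.AgrT (j + 1) (T q))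
    (hs : ∀ q, P.AgrT 0 (T q)) {n : ℕ} (h : P.AgrT n (T 0))
    (hn : ∀ I, P.Matches (pairComp (T n) I)) : P.AgrT (n + 1) (T 0) := by
  have key : ∀ j q, q + j = n → P.AgrT (j + 1) (T q) := by
    intro j
    induction j with
    | zero =>
      intro q hq
      rw [add_zero] at hq
      subst hq
      exact hu q 0 hn (hs (q + 1))
    | succ j ih =>
      intro q hq
      exact hu q (j + 1) (fun I => (tower_down hd h q (j + 1) hq I).matches)
        (ih (q + 1) (by omega))
  exact key n 0 (zero_add n)

lemma SymAgr.of_subsingleton {k m : ℕ} [Subsingleton (Equiv.Perm (Fin m))]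
    {T : Bool → TensorField 𝕜 m} : P.SymAgr k T := by
  intro σ I
  rw [Subsingleton.elim σ 1]
  exact (Agr.const (r := 0) (map_zero _)).congr fun i p _ => by simp

/-- The tower of covariant derivatives of a pair of functions. -/
def funTower (P : FramePair 𝕜) (f : Bool → Pt 𝕜 → 𝕜) (q : ℕ) : Bool → TensorField 𝕜 q :=
  fun b => iterCovFun (P.h b) (f b) q

/-- The tower of covariant derivatives of a pair of tensor fields. -/
def tensorTower (P : FramePair 𝕜) {k : ℕ} (T : Bool → TensorField 𝕜 k) (q : ℕ) :
    Bool → TensorField 𝕜 (k + q) :=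
  fun b => iterCov (P.h b) (T b) q

lemma smoothT_funTower {f : Bool → Pt 𝕜 → 𝕜} (hf : ∀ b, ContDiffOn 𝕜 ∞ (f b) (P.N b)) (q : ℕ) :
    P.SmoothT (P.funTower f q) := by
  induction q with
  | zero => exact fun b _ => hf b
  | succ q ih => exact ih.D

lemma smoothT_tensorTower {k : ℕ} {T : Bool → TensorField 𝕜 k} (hT : P.SmoothT T) (q : ℕ) :
    P.SmoothT (P.tensorTower T q) := by
  induction q with
  | zero => exact hT
  | succ q ih => exact ih.D

lemma AgrT.funTower {f : Bool → Pt 𝕜 → 𝕜} (hf : ∀ b, ContDiffOn 𝕜 ∞ (f b) (P.N b)) {n : ℕ}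
    (h : P.AgrT n (P.funTower f 0)) (q j : ℕ) (hq : q + j = n) : P.AgrT j (P.funTower f q) :=
  tower_down (T := P.funTower f) (fun q _ h => h.D (smoothT_funTower hf q)) h q j hq

lemma AgrT.tensorTower {k : ℕ} {T : Bool → TensorField 𝕜 k} (hT : P.SmoothT T) {n : ℕ}
    (h : P.AgrT n (P.tensorTower T 0)) (q j : ℕ) (hq : q + j = n) :
    P.AgrT j (P.tensorTower T q) :=
  tower_down (T := P.tensorTower T) (fun q _ h => h.D (smoothT_tensorTower hT q)) h q j hq

lemma AgrT.funTower_up {f : Bool → Pt 𝕜 → 𝕜} (hf : ∀ b, ContDiffOn 𝕜 ∞ (f b) (P.N b)) {n : ℕ}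
    (h : P.AgrT n (P.funTower f 0)) (hn : ∀ I, P.Matches (pairComp (P.funTower f n) I)) :
    P.AgrT (n + 1) (P.funTower f 0) :=
  tower_up (T := P.funTower f) (fun q _ h => h.D (smoothT_funTower hf q))
    (fun q _ h0 h => AgrT.of_D (smoothT_funTower hf q) h0 h)
    (fun q => (smoothT_funTower hf q).smooth) h hn

lemma AgrT.tensorTower_up {k : ℕ} {T : Bool → TensorField 𝕜 k} (hT : P.SmoothT T) {n : ℕ}
    (h : P.AgrT n (P.tensorTower T 0)) (hn : ∀ I, P.Matches (pairComp (P.tensorTower T n) I)) :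
    P.AgrT (n + 1) (P.tensorTower T 0) :=
  tower_up (T := P.tensorTower T) (fun q _ h => h.D (smoothT_tensorTower hT q))
    (fun q _ h0 h => AgrT.of_D (smoothT_tensorTower hT q) h0 h)
    (fun q => (smoothT_tensorTower hT q).smooth) h hn

lemma AgrT.mono {k l m : ℕ} {T : Bool → TensorField 𝕜 m} (h : P.AgrT l T) (hkl : k ≤ l) :
    P.AgrT k T := fun I => (h I).mono hkl

/-- Symmetry holds to one order more than the values are known (`n + 1` instead of `n`): an exchange
of two derivatives trades them for a curvature factor, which lowers the required order by two. -/
lemma symAgr_funTower {f : Bool → Pt 𝕜 → 𝕜} (hf : ∀ b, ContDiffOn 𝕜 ∞ (f b) (P.N b)) {n : ℕ}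
    (h : P.AgrT n (P.funTower f 0)) (hr : ∀ a b, P.Agr (n - 1) (P.ric a b)) :
    ∀ q k, q + k = n + 1 → P.SymAgr k (P.funTower f q) := by
  intro q
  induction q with
  | zero => intro k _; exact SymAgr.of_subsingleton
  | succ q ih =>
    intro k hk
    cases q with
    | zero => exact SymAgr.of_subsingleton (m := 1)
    | succ q =>
      refine SymAgr.D (smoothT_funTower hf (q + 1)) (ih (k + 1) (by omega)) fun a b I => ?_
      exact agr_D_D_comm (smoothT_funTower hf q)
        (AgrT.mono (AgrT.funTower hf h q (k + 1) (by omega)) (by omega))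
        (fun a b => (hr a b).mono (by omega)) a b I

lemma trAgr_funTower {f : Bool → Pt 𝕜 → 𝕜} (hf : ∀ b, ContDiffOn 𝕜 ∞ (f b) (P.N b)) {n : ℕ}
    (h : P.TrAgr n (P.funTower f 2)) :
    ∀ q k, q + k = n → P.TrAgr k (P.funTower f (q + 2)) := by
  intro q
  induction q with
  | zero => intro k hk; rw [zero_add] at hk; subst hk; exact h
  | succ q ih =>
    intro k hk
    exact (ih (k + 1) (by omega)).D (smoothT_funTower hf (q + 2))

lemma trAgr_tensorTower {k : ℕ} {T : Bool → TensorField 𝕜 k} (hT : P.SmoothT T)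
    (h : ∀ n, P.TrAgr n T) (q : ℕ) : ∀ n, P.TrAgr n (P.tensorTower T q) := by
  induction q with
  | zero => exact h
  | succ q ih => exact fun n => (ih (n + 1)).D (smoothT_tensorTower hT q)

/-- The first derivative index meets a tensor index, which is a curl and not a commutator; `h1`
provides that exchange. All later exchanges come from the Ricci identity. -/
lemma symAgr_tensorTower {m : ℕ} {T : Bool → TensorField 𝕜 (m + 1)} (hT : P.SmoothT T) {n : ℕ}
    (h : P.AgrT n (P.tensorTower T 0)) (hr : ∀ a b, P.Agr n (P.ric a b))
    (h0 : ∀ k, P.SymAgr k T)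
    (h1 : ∀ a b (I : Fin m → Fin 3), P.Agr n (fun i p =>
      pairComp (P.D T) (Fin.cons a (Fin.cons b I)) i p - pairComp (P.D T) (Fin.cons b (Fin.cons a I)) i p)) :
    ∀ q k, q + k = n + 1 → P.SymAgr k (P.tensorTower T q) := by
  intro q
  induction q with
  | zero => intro k _; exact h0 k
  | succ q ih =>
    intro k hk
    cases q with
    | zero =>
      obtain rfl : k = n := by omega
      exact SymAgr.D hT (h0 _) h1
    | succ q =>
      refine SymAgr.D (n := m + 1 + q) (smoothT_tensorTower hT (q + 1)) (ih (k + 1) (by omega))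
        fun a b I => ?_
      exact agr_D_D_comm (smoothT_tensorTower hT q)
        (AgrT.mono (AgrT.tensorTower hT h q (k + 1) (by omega)) (by omega))
        (fun a b => (hr a b).mono (by omega)) a b I

end FramePair

/-! ### Pairs of solutions and the induction over orders -/

variable {𝕜 : Type*} [RCLike 𝕜]

lemma ConformalFields.IsSolution.isMetricOn {F : ConformalFields 𝕜} (hF : F.IsSolution) :
    IsMetricOn F.N F.h :=
  ⟨hF.isOpen_N, hF.smooth_h, hF.metric_symm, hF.metric_nondeg⟩

/-- Two solutions of the field equations with orthonormal frames at the distinguished points, to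
be compared along a homomorphism of the ground field. -/
structure SolutionPair (𝕜 : Type*) [RCLike 𝕜] where
  /-- The solutions. -/
  F : Bool → ConformalFields 𝕜
  /-- The frames. -/
  c : Bool → Fin 3 → Fin 3 → 𝕜
  /-- The sign of the metric. -/
  sgn : ℤˣ
  /-- The homomorphism used for the comparison. -/
  θ : 𝕜 →+* 𝕜
  sol : ∀ b, (F b).IsSolution
  orth : ∀ b, frameMetric (F b).h ((F b).i, c b) =
    ((sgn : ℤ) : 𝕜) • (1 : Matrix (Fin 3) (Fin 3) 𝕜)

namespace SolutionPair

variable (X : SolutionPair 𝕜)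

/-- The underlying pair of metrics with frames. -/
def pair : FramePair 𝕜 where
  N b := (X.F b).N
  h b := (X.F b).h
  pt b := ((X.F b).i, X.c b)
  θ := X.θ
  sgn := X.sgn
  metric b := (X.sol b).isMetricOn
  mem b := by
    refine ⟨(X.sol b).i_mem, fun h0 => ?_⟩
    have h1 := congrArg Matrix.det (X.orth b)
    rw [frameMetric, Matrix.det_mul, Matrix.det_mul, h0, zero_mul, zero_mul] at h1
    rcases Int.units_eq_one_or X.sgn with hs | hs <;> norm_num [hs, Matrix.det_neg] at h1
  orthonormal := X.orth

/-- The potential. -/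
def φ (b : Bool) : Pt 𝕜 → 𝕜 := (X.F b).φ
/-- The conformal factor. -/
def Ω (b : Bool) : Pt 𝕜 → 𝕜 := (X.F b).Ω
/-- The Ricci scalar. -/
def R (b : Bool) : Pt 𝕜 → 𝕜 := (X.F b).R
/-- The trace free part of the Ricci tensor. -/
def S (b : Bool) : TensorField 𝕜 2 := (X.F b).S

lemma smooth_φ (b : Bool) : ContDiffOn 𝕜 ∞ (X.φ b) (X.pair.N b) := (X.sol b).smooth_φ
lemma smooth_Ω (b : Bool) : ContDiffOn 𝕜 ∞ (X.Ω b) (X.pair.N b) := (X.sol b).smooth_Ω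
lemma smooth_R (b : Bool) : ContDiffOn 𝕜 ∞ (X.R b) (X.pair.N b) := (X.sol b).smooth_R
lemma smoothT_S : X.pair.SmoothT X.S := fun b => (X.sol b).smooth_S

open FramePair

lemma cmp_funTower_zero {P : FramePair 𝕜} (f : Bool → Pt 𝕜 → 𝕜) (I : Fin 0 → Fin 3) :
    pairComp (P.funTower f 0) I = fun b p => f b p.1 := by
  funext b p
  simp [pairComp, comp, frameComp, funTower, iterCovFun]

lemma cmp_funTower_one {P : FramePair 𝕜} (f : Bool → Pt 𝕜 → 𝕜) (a : Fin 3) (b : Bool)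
    (p : Fr 𝕜) : pairComp (P.funTower f 1) ![a] b p =
      frameCovec p.2 (fun m => iterCovFun (P.h b) (f b) 1 p.1 ![m]) a := comp_one _ _ _

lemma cmp_two {T : Bool → TensorField 𝕜 2} (a a' : Fin 3) (b : Bool)
    (p : Fr 𝕜) : pairComp T ![a, a'] b p =
      frameBilin p.2 (fun m n => T b p.1 ![m, n]) a a' := comp_two _ _ _ _

lemma eq_vec_one (I : Fin 1 → Fin 3) : I = ![I 0] := by
  funext j; fin_cases j; rfl

lemma eq_vec_two (I : Fin 2 → Fin 3) : I = ![I 0, I 1] := by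
  funext j; fin_cases j <;> rfl

lemma update_update_two (I : Fin 2 → Fin 3) (a b : Fin 3) :
    Function.update (Function.update I 0 a) 1 b = ![a, b] := by
  funext j; fin_cases j <;> simp

lemma denom_ne_zero (b : Bool) (p : Fr 𝕜) (hp : p ∈ X.pair.U b) :
    1 + X.Ω b p.1 - X.φ b p.1 ^ 2 ≠ 0 := (X.sol b).denom_ne_zero _ hp.1

lemma laplace : X.pair.EqU (X.pair.tr fun a b => pairComp (X.pair.funTower X.φ 2) ![a, b])
    (fun i p => rhsLaplace (frameMetric (X.pair.h i) p)⁻¹ (X.φ i p.1) (X.Ω i p.1) (X.R i p.1)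
      (fun a => pairComp (X.pair.funTower X.φ 1) ![a] i p)
      (fun a => pairComp (X.pair.funTower X.Ω 1) ![a] i p)) := by
  intro i p hp
  simp only [tr, cmp_two, cmp_funTower_one]
  rw [← rhsLaplace_frame hp]
  have h1 := sum_inv_mul_frame (h := (X.F i).h) hp ((X.F i).hessφ p.1)
  exact h1.symm.trans ((X.sol i).eq_laplace p.1 hp.1)

lemma hessΩ (a b : Fin 3) : X.pair.EqU (pairComp (X.pair.funTower X.Ω 2) ![a, b])
    (fun i p => rhsHessOmega (frameMetric (X.pair.h i) p) (frameMetric (X.pair.h i) p)⁻¹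
      (X.φ i p.1) (X.Ω i p.1) (X.R i p.1) (fun a b => pairComp X.S ![a, b] i p)
      (fun a => pairComp (X.pair.funTower X.φ 1) ![a] i p)
      (fun a => pairComp (X.pair.funTower X.Ω 1) ![a] i p) a b) := by
  intro i p hp
  simp only [cmp_two, cmp_funTower_one]
  have h1 := rhsHessOmega_frame (h := (X.F i).h) hp ((X.F i).φ p.1) ((X.F i).Ω p.1)
    ((X.F i).R p.1) ((X.F i).Sc p.1) ((X.F i).dφ p.1) ((X.F i).dΩ p.1) a b
  refine Eq.trans ?_ h1
  simp only [frameBilin]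
  exact Finset.sum_congr rfl fun m _ => Finset.sum_congr rfl fun n _ =>
    congrArg _ ((X.sol i).eq_hessΩ p.1 hp.1 m n)

lemma gradR (a : Fin 3) : X.pair.EqU (pairComp (X.pair.funTower X.R 1) ![a])
    (fun i p => rhsGradR (frameMetric (X.pair.h i) p)⁻¹
      (X.φ i p.1) (X.Ω i p.1) (X.R i p.1) (fun a b => pairComp X.S ![a, b] i p)
      (fun a => pairComp (X.pair.funTower X.φ 1) ![a] i p)
      (fun a => pairComp (X.pair.funTower X.Ω 1) ![a] i p)
      (fun a b => pairComp (X.pair.funTower X.φ 2) ![a, b] i p) a) := by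
  intro i p hp
  simp only [cmp_two, cmp_funTower_one]
  have h1 := rhsGradR_frame (h := (X.F i).h) hp ((X.F i).φ p.1) ((X.F i).Ω p.1)
    ((X.F i).R p.1) ((X.F i).Sc p.1) ((X.F i).dφ p.1) ((X.F i).dΩ p.1) ((X.F i).hessφ p.1) a
  refine Eq.trans ?_ h1
  simp only [frameCovec]
  exact Finset.sum_congr rfl fun m _ => congrArg _ ((X.sol i).eq_gradR p.1 hp.1 m)

/-- The factor `2` undoes the weight one half in the antisymmetrization. -/
lemma curlS (a b c : Fin 3) : X.pair.EqU
    (fun i p => pairComp (X.pair.D X.S) ![c, b, a] i p - pairComp (X.pair.D X.S) ![b, c, a] i p)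
    (fun i p => 2 * rhsCurlS (frameMetric (X.pair.h i) p) (frameMetric (X.pair.h i) p)⁻¹
      (X.φ i p.1) (X.Ω i p.1) (X.R i p.1) (fun a b => pairComp X.S ![a, b] i p)
      (fun a => pairComp (X.pair.funTower X.φ 1) ![a] i p)
      (fun a => pairComp (X.pair.funTower X.Ω 1) ![a] i p)
      (fun a b => pairComp (X.pair.funTower X.φ 2) ![a, b] i p) a b c) := by
  intro i p hp
  simp only [cmp_two, cmp_funTower_one]
  have h1 := rhsCurlS_frame (h := (X.F i).h) hp ((X.F i).φ p.1) ((X.F i).Ω p.1)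
    ((X.F i).R p.1) ((X.F i).Sc p.1) ((X.F i).dφ p.1) ((X.F i).dΩ p.1) ((X.F i).hessφ p.1) a b c
  refine Eq.trans ?_ (congrArg (fun z => 2 * z) h1)
  have h2 : ∀ a b c, rhsCurlS ((X.F i).h p.1) ((X.F i).h p.1)⁻¹ ((X.F i).φ p.1) ((X.F i).Ω p.1)
      ((X.F i).R p.1) ((X.F i).Sc p.1) ((X.F i).dφ p.1) ((X.F i).dΩ p.1)
      ((X.F i).hessφ p.1) a b c = 1 / 2 * ((X.F i).dS p.1 c b a - (X.F i).dS p.1 b c a) :=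
    fun a b c => ((X.sol i).eq_curlS p.1 hp.1 a b c).symm
  simp only [contr, h2, pairComp, comp_three]
  change ∑ m, ∑ n, ∑ l, p.2 c m * (p.2 b n * p.2 a l) * (X.F i).dS p.1 m n l -
    ∑ m, ∑ n, ∑ l, p.2 b m * (p.2 c n * p.2 a l) * (X.F i).dS p.1 m n l = _
  generalize (X.F i).dS p.1 = dS
  simp only [Fin.sum_univ_three]
  ring

lemma ric_eq (a b : Fin 3) : X.pair.EqU (X.pair.ric a b)
    (fun i p => pairComp X.S ![a, b] i p + 1 / 3 * frameMetric (X.pair.h i) p a b * X.R i p.1) := by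
  intro i p hp
  simp only [ric, cmp_two, frameBilin, frameMetric_apply, Finset.mul_sum, Finset.sum_mul,
    ← Finset.sum_add_distrib]
  refine Finset.sum_congr rfl fun m _ => Finset.sum_congr rfl fun n _ => ?_
  have := (X.sol i).eq_ricci p.1 hp.1 m n
  change _ * _ * ricci (X.F i).h p.1 m n = _ * _ * (X.F i).Sc p.1 m n +
    1 / 3 * (_ * _ * (X.F i).h p.1 m n) * (X.F i).R p.1
  rw [this]
  ring

lemma symAgr_S (k : ℕ) : X.pair.SymAgr k X.S := by
  refine SymAgr.of_swap fun j I => ?_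
  refine (Agr.const (r := 0) (map_zero _)).congr fun i p hp => ?_
  rw [eq_vec_two I]
  have : (![I 0, I 1] ∘ Equiv.swap j.castSucc j.succ : Fin 2 → Fin 3) = ![I 1, I 0] := by
    fin_cases j
    funext l
    fin_cases l <;> rfl
  beta_reduce
  rw [this, cmp_two, cmp_two, eq_comm, sub_eq_zero]
  simp only [frameBilin]
  rw [Finset.sum_comm]
  refine Finset.sum_congr rfl fun m _ => Finset.sum_congr rfl fun n _ => ?_
  have := (X.sol i).S_symm p.1 hp.1 m n
  change _ * (X.F i).Sc p.1 n m = _ * (X.F i).Sc p.1 m n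
  rw [this]
  ring

lemma trAgr_S (k : ℕ) : X.pair.TrAgr k X.S := by
  refine ⟨0, 1, by decide, fun I => ?_⟩
  refine (Agr.const (r := 0) (map_zero _)).congr fun i p hp => ?_
  simp only [update_update_two, tr, cmp_two]
  have h1 := sum_inv_mul_frame (h := (X.F i).h) hp ((X.F i).Sc p.1)
  exact ((X.sol i).S_tracefree p.1 hp.1).symm.trans h1

lemma matches_of_eq {P : FramePair 𝕜} {f : FunPair 𝕜} {r : 𝕜} (hr : P.θ r = r)
    (h : ∀ b, f b (P.pt b) = r) : P.Matches f := by
  unfold Matches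
  rw [h, h, hr]

lemma agr_val {P : FramePair 𝕜} {f : Bool → Pt 𝕜 → 𝕜} {n : ℕ} (h : P.AgrT n (P.funTower f 0)) :
    P.Agr n (fun b p => f b p.1) := by
  rw [← cmp_funTower_zero (P := P) f ![]]
  exact h ![]

/-- Agreement of all the fields up to a given order. -/
def Good (n : ℕ) : Prop :=
  X.pair.AgrT n (X.pair.funTower X.φ 0) ∧ X.pair.AgrT n (X.pair.funTower X.Ω 0) ∧
    -- `R` and `S` stay one order behind: the equations for their first derivatives contain the
    -- Hessian of `φ`.
    X.pair.AgrT (n - 1) (X.pair.funTower X.R 0) ∧ X.pair.AgrT (n - 1) X.S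

variable {X}

lemma Good.ric {n : ℕ} (h : X.Good n) (a b : Fin 3) : X.pair.Agr (n - 1) (X.pair.ric a b) := by
  refine Agr.congr ?_ (X.ric_eq a b).symm
  exact (h.2.2.2 _).add (((Agr.const (by simp [θ_ofNat])).mul (agr_frameMetric _ _ _)).mul
    (agr_val h.2.2.1))

lemma Good.d {P : FramePair 𝕜} {f : Bool → Pt 𝕜 → 𝕜} (hf : ∀ b, ContDiffOn 𝕜 ∞ (f b) (P.N b))
    {n : ℕ} (h : P.AgrT n (P.funTower f 0)) : P.AgrT (n - 1) (P.funTower f 1) := by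
  cases n with
  | zero => exact (smoothT_funTower hf 1).smooth
  | succ n => exact AgrT.funTower hf h 1 n (by omega)

/-- The `n`-th derivatives of `φ` are symmetric and have prescribed traces modulo quantities that
already agree, so the null data match them. For `n = 0` the value is prescribed at `i`. -/
lemma Good.φ_succ (hφ : ∀ p, 1 ≤ p →
      symmetrize (toSpinor fun I => pairComp (X.pair.funTower X.φ p) I true (X.pair.pt true)) =
      symmetrize (toSpinor fun I =>
        X.θ (pairComp (X.pair.funTower X.φ p) I false (X.pair.pt false))))
    {n : ℕ} (h : X.Good n) : X.pair.AgrT (n + 1) (X.pair.funTower X.φ 0) := by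
  refine AgrT.funTower_up X.smooth_φ h.1 fun I => ?_
  cases n with
  | zero =>
    rw [cmp_funTower_zero]
    exact matches_of_eq (map_zero _) fun b => (X.sol b).φ_at_i
  | succ n =>
    refine matches_of_symmetrize (symAgr_funTower X.smooth_φ h.1 h.ric (n + 1) 1 (by omega))
      (fun j l hjl => ?_) (hφ (n + 1) (by omega)) I
    cases n with
    -- In rank one there is no trace to control.
    | zero => exact absurd (Subsingleton.elim (α := Fin 1) j l) hjl
    | succ n =>
      refine trAgr_funTower (n := n + 1) X.smooth_φ ?_ n 1 rfl
      refine ⟨0, 1, by decide, fun I => ?_⟩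
      simp only [update_update_two]
      refine Agr.congr ?_ X.laplace.symm
      exact agr_rhsLaplace (agr_val h.1).pred (agr_val h.2.1).pred (agr_val h.2.2.1)
        (fun a => Good.d X.smooth_φ h.1 _) (fun a => Good.d X.smooth_Ω h.2.1 _) X.denom_ne_zero

/-- Value and gradient vanish at `i`, and the Hessian equation expresses everything else through
known orders; no free data enter. -/
lemma Good.Ω_succ {n : ℕ} (h : X.Good n) :
    X.pair.AgrT (n + 1) (X.pair.funTower X.Ω 0) := by
  have hs := smoothT_funTower X.smooth_Ω
  refine AgrT.of_D (hs 0) (fun I => ?_) ?_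
  · rw [cmp_funTower_zero]
    exact matches_of_eq (map_zero _) fun b => (X.sol b).Ω_at_i
  · cases n with
    | zero => exact (hs 1).smooth
    | succ n =>
      refine AgrT.of_D (hs 1) (fun I => ?_) fun I => ?_
      · refine matches_of_eq (map_zero _) fun b => ?_
        rw [eq_vec_one I]
        refine (cmp_funTower_one _ _ _ _).trans (Finset.sum_eq_zero fun m _ => ?_)
        exact (congrArg _ ((X.sol b).dΩ_at_i m)).trans (mul_zero _)
      · rw [eq_vec_two I]
        refine Agr.congr ?_ (X.hessΩ (I 0) (I 1)).symm
        exact agr_rhsHessOmega (agr_val h.1).pred (agr_val h.2.1).pred (agr_val h.2.2.1)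
          (fun a b => h.2.2.2 _) (fun a => Good.d X.smooth_φ h.1 _)
          (fun a => Good.d X.smooth_Ω h.2.1 _) X.denom_ne_zero _ _

/-- The Hessian of `φ` in the gradient equation requires the order of `φ` to have been raised
already, which is `hφ`. The value of `R` at `i` is a function of the gradient of `φ` there. -/
lemma Good.R_succ {n : ℕ} (h : X.Good n)
    (hφ : X.pair.AgrT (n + 1) (X.pair.funTower X.φ 0)) :
    X.pair.AgrT n (X.pair.funTower X.R 0) := by
  have hs := smoothT_funTower X.smooth_R
  have hdφ := Good.d X.smooth_φ hφ
  cases n with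
  | zero => exact (hs 0).smooth
  | succ n =>
    refine AgrT.of_D (hs 0) (fun I => ?_) fun I => ?_
    · rw [cmp_funTower_zero]
      have h1 : X.pair.Agr (n + 1) (fun i p => -(6 + 8 * ip (frameMetric (X.pair.h i) p)⁻¹
          (fun a => pairComp (X.pair.funTower X.φ 1) ![a] i p)
          (fun a => pairComp (X.pair.funTower X.φ 1) ![a] i p))) :=
        ((Agr.const (θ_ofNat 6)).add ((Agr.const (θ_ofNat 8)).mul
          (Agr.ip (fun a => hdφ _) fun a => hdφ _))).neg
      have h2 : ∀ b, X.R b (X.pair.pt b).1 = -(6 + 8 *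
          ip (frameMetric (X.pair.h b) (X.pair.pt b))⁻¹
          (fun a => pairComp (X.pair.funTower X.φ 1) ![a] b (X.pair.pt b))
          (fun a => pairComp (X.pair.funTower X.φ 1) ![a] b (X.pair.pt b))) := by
        intro b
        simp only [cmp_funTower_one]
        rw [← ip_frame (X.pair.mem b)]
        exact (X.sol b).R_at_i
      have h3 := h1.matches
      unfold Matches at h3 ⊢
      beta_reduce
      rw [h2, h2]
      exact h3
    · rw [eq_vec_one I]
      refine Agr.congr ?_ (X.gradR (I 0)).symm
      exact agr_rhsGradR (agr_val h.1).pred (agr_val h.2.1).pred (agr_val h.2.2.1)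
          (fun a b => h.2.2.2 _) (fun a => (hdφ _).pred)
          (fun a => Good.d X.smooth_Ω h.2.1 _)
          (fun a b => hdφ.D (smoothT_funTower X.smooth_φ 1) _) X.denom_ne_zero _

/-- The curl equation, with the Hessian of `φ` supplied by `hφ`, makes the derivatives of `S`
symmetric modulo agreeing terms. Their trace vanishes because `S` is trace-free, and the null data
fix the rest. -/
lemma Good.S_succ (hS : ∀ q,
      symmetrize (toSpinor fun I => pairComp (X.pair.tensorTower X.S q) I true (X.pair.pt true)) =
      symmetrize (toSpinor fun I =>
        X.θ (pairComp (X.pair.tensorTower X.S q) I false (X.pair.pt false))))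
    {n : ℕ} (h : X.Good n) (hφ : X.pair.AgrT (n + 1) (X.pair.funTower X.φ 0)) :
    X.pair.AgrT n X.S := by
  have hdφ := Good.d X.smooth_φ hφ
  cases n with
  | zero => exact X.smoothT_S.smooth
  | succ n =>
    refine AgrT.tensorTower_up (n := n) X.smoothT_S h.2.2.2 fun I => ?_
    refine matches_of_symmetrize (symAgr_tensorTower X.smoothT_S h.2.2.2 h.ric X.symAgr_S
      (fun a b I => ?_) n 1 rfl) (fun j l _ => trAgr_tensorTower X.smoothT_S X.trAgr_S n 1)
      (hS n) I
    have h1 : ∀ a b : Fin 3, (Fin.cons a (Fin.cons b I) : Fin 3 → Fin 3) = ![a, b, I 0] := by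
      intro a b
      rw [eq_vec_one I]
      rfl
    refine Agr.congr ?_ (show X.pair.EqU _ _ from fun i p hp => ?_) (f := fun i p => 2 *
      rhsCurlS (frameMetric (X.pair.h i) p) (frameMetric (X.pair.h i) p)⁻¹
      (X.φ i p.1) (X.Ω i p.1) (X.R i p.1) (fun a b => pairComp X.S ![a, b] i p)
      (fun a => pairComp (X.pair.funTower X.φ 1) ![a] i p)
      (fun a => pairComp (X.pair.funTower X.Ω 1) ![a] i p)
      (fun a b => pairComp (X.pair.funTower X.φ 2) ![a, b] i p) (I 0) b a)
    · exact (Agr.const (θ_ofNat 2)).mul (agr_rhsCurlS (agr_val h.1).pred (agr_val h.2.1).pred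
          (agr_val h.2.2.1) (fun a b => h.2.2.2 _) (fun a => (hdφ _).pred)
          (fun a => Good.d X.smooth_Ω h.2.1 _)
          (fun a b => hdφ.D (smoothT_funTower X.smooth_φ 1) _) X.denom_ne_zero _ _ _)
    · have h2 := X.curlS (I 0) b a i hp
      beta_reduce at h2 ⊢
      rw [← h2]
      exact congrArg₂ (fun J J' => pairComp (X.pair.D X.S) J i p - pairComp (X.pair.D X.S) J' i p)
        (h1 a b).symm (h1 b a).symm

/-- Solutions with the same null data agree to all orders. -/
theorem good (hφ : ∀ p, 1 ≤ p →
      symmetrize (toSpinor fun I => pairComp (X.pair.funTower X.φ p) I true (X.pair.pt true)) =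
      symmetrize (toSpinor fun I =>
        X.θ (pairComp (X.pair.funTower X.φ p) I false (X.pair.pt false))))
    (hS : ∀ q,
      symmetrize (toSpinor fun I => pairComp (X.pair.tensorTower X.S q) I true (X.pair.pt true)) =
      symmetrize (toSpinor fun I =>
        X.θ (pairComp (X.pair.tensorTower X.S q) I false (X.pair.pt false)))) (n : ℕ) :
    X.Good n := by
  induction n with
  | zero =>
    exact ⟨(smoothT_funTower X.smooth_φ 0).smooth, (smoothT_funTower X.smooth_Ω 0).smooth,
      (smoothT_funTower X.smooth_R 0).smooth, X.smoothT_S.smooth⟩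
  | succ n ih =>
    have h1 := ih.φ_succ hφ
    exact ⟨h1, ih.Ω_succ, ih.R_succ h1, ih.S_succ hS h1⟩

end SolutionPair

/-! ### From agreement to the normal expansion coefficients -/

namespace ConformalFields

variable {𝕜 : Type*} [RCLike 𝕜]

/-- The normal expansion coefficients in the frame. -/
def frameFunCoeff (F : ConformalFields 𝕜) (c : Pt 𝕜 → Fin 3 → Fin 3 → 𝕜) (f : Pt 𝕜 → 𝕜) (p : ℕ)
    (I : Fin p → Fin 3) : 𝕜 := frameComp (c F.i) (iterCovFun F.h f p F.i) I

/-- The normal expansion coefficients of `S` in the frame. -/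
def frameSCoeff (F : ConformalFields 𝕜) (c : Pt 𝕜 → Fin 3 → Fin 3 → 𝕜) (p : ℕ)
    (I : Fin (2 + p) → Fin 3) : 𝕜 := frameComp (c F.i) (iterCov F.h F.S p F.i) I

/-- The null data determine the normal expansion coefficients, up to a homomorphism of the
ground field. -/
theorem frameCoeff_eq {F F' : ConformalFields 𝕜} {c c' : Pt 𝕜 → Fin 3 → Fin 3 → 𝕜} {s : ℤˣ}
    (θ : 𝕜 →+* 𝕜) (hF : F.IsSolution) (hc : F.IsNormalFrame s c) (hF' : F'.IsSolution)
    (hc' : F'.IsNormalFrame s c')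
    (hφ : ∀ p, 1 ≤ p → symmetrize (F'.funCoeff c' F'.φ p) =
      symmetrize (toSpinor fun I => θ (F.frameFunCoeff c F.φ p I)))
    (hS : ∀ q, symmetrize (F'.SCoeff c' q) =
      symmetrize (toSpinor fun I => θ (F.frameSCoeff c q I))) (p : ℕ) :
    (∀ I, F'.frameFunCoeff c' F'.φ p I = θ (F.frameFunCoeff c F.φ p I)) ∧
    (∀ I, F'.frameFunCoeff c' F'.Ω p I = θ (F.frameFunCoeff c F.Ω p I)) ∧
    (∀ I, F'.frameFunCoeff c' F'.R p I = θ (F.frameFunCoeff c F.R p I)) ∧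
    (∀ I, F'.frameSCoeff c' p I = θ (F.frameSCoeff c p I)) := by
  have orth : ∀ {F : ConformalFields 𝕜} {c : Pt 𝕜 → Fin 3 → Fin 3 → 𝕜}, F.IsSolution →
      F.IsNormalFrame s c → frameMetric F.h (F.i, c F.i) =
        ((s : ℤ) : 𝕜) • (1 : Matrix (Fin 3) (Fin 3) 𝕜) := by
    intro F c hF hc
    ext a b
    rw [frameMetric_apply, Matrix.smul_apply, Matrix.one_apply, smul_eq_mul, mul_ite, mul_one,
      mul_zero, ← hc.orthonormal F.i hF.i_mem a b]
    exact Finset.sum_congr rfl fun m _ => Finset.sum_congr rfl fun n _ => by ring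
  let X : SolutionPair 𝕜 :=
    { F := fun b => if b then F' else F
      c := fun b => if b then c' F'.i else c F.i
      sgn := s
      θ := θ
      sol := fun b => by cases b <;> simpa
      orth := fun b => by cases b <;> simp [orth, hF, hF', hc, hc'] }
  -- After `p` derivatives, order `p + 2` leaves order two for `φ`, `Ω` and, because of the lag,
  -- order one for `R`, `S`; order one is what matching of values requires.
  have hg := SolutionPair.good (X := X) hφ hS (p + 2)
  refine ⟨fun I => ?_, fun I => ?_, fun I => ?_, fun I => ?_⟩
  · exact (FramePair.AgrT.funTower X.smooth_φ hg.1 p 2 rfl I).matches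
  · exact (FramePair.AgrT.funTower X.smooth_Ω hg.2.1 p 2 rfl I).matches
  · exact (FramePair.AgrT.funTower X.smooth_R hg.2.2.1 p 1 rfl I).matches
  · exact (FramePair.AgrT.tensorTower X.smoothT_S hg.2.2.2 p 1 rfl I).matches

end ConformalFields

end ConfStat

end

/-! ### Uniqueness and reality -/

open ConfStat in
theorem mainTheorem3 {𝕜 : Type*} [RCLike 𝕜] (s : ℤˣ)
    (ψ Ψ : (p : ℕ) → Spinor p)
    (hψ : ∀ p, 1 ≤ p → IsTotallySymmetric (ψ p) ∧ IsRealSpinor (ψ p))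
    (hΨ : ∀ p, 2 ≤ p → IsTotallySymmetric (Ψ p) ∧ IsRealSpinor (Ψ p)) :
    (∀ (F F' : ConformalFields 𝕜) (c c' : Pt 𝕜 → Fin 3 → Fin 3 → 𝕜),
      F.IsSolution → F.IsNormalFrame s c → F.HasNullData c ψ Ψ →
      F'.IsSolution → F'.IsNormalFrame s c' → F'.HasNullData c' ψ Ψ →
      ∀ p, F.funCoeff c F.φ p = F'.funCoeff c' F'.φ p ∧
        F.funCoeff c F.Ω p = F'.funCoeff c' F'.Ω p ∧
        F.funCoeff c F.R p = F'.funCoeff c' F'.R p ∧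
        F.SCoeff c p = F'.SCoeff c' p) ∧
    (∀ (F : ConformalFields 𝕜) (c : Pt 𝕜 → Fin 3 → Fin 3 → 𝕜),
      F.IsSolution → F.IsNormalFrame s c → F.HasNullData c ψ Ψ →
      ∀ p, IsRealSpinor (F.funCoeff c F.φ p) ∧
        IsRealSpinor (F.funCoeff c F.Ω p) ∧
        IsRealSpinor (F.funCoeff c F.R p) ∧
        IsRealSpinor (F.SCoeff c p)) := by
  constructor
  · intro F F' c c' hF hc hn hF' hc' hn' p
    -- Uniqueness: two solutions compared along the identity.
    obtain ⟨h1, h2, h3, h4⟩ := ConformalFields.frameCoeff_eq (RingHom.id 𝕜) hF hc hF' hc'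
      (fun p hp => (hn'.1 p hp).symm.trans (hn.1 p hp))
      (fun q => (hn'.2 q).symm.trans (hn.2 q)) p
    exact ⟨congrArg toSpinor (funext fun I => (h1 I).symm),
      congrArg toSpinor (funext fun I => (h2 I).symm),
      congrArg toSpinor (funext fun I => (h3 I).symm),
      congrArg toSpinor (funext fun I => (h4 I).symm)⟩
  · intro F c hF hc hn p
    -- Reality: one solution compared with itself along conjugation. Conjugation is applied only to
    -- values at the distinguished frame, so it does not matter that it is not holomorphic.
    obtain ⟨h1, h2, h3, h4⟩ := ConformalFields.frameCoeff_eq (starRingEnd 𝕜) hF hc hF hc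
      (fun p hp => (symmetrize_star_of_isRealSpinor (by
        have := (hψ p hp).2
        rwa [hn.1 p hp] at this)).symm)
      (fun q => (symmetrize_star_of_isRealSpinor (by
        have := (hΨ (2 + q) (by omega)).2
        rwa [hn.2 q] at this)).symm) p
    exact ⟨isRealSpinor_toSpinor fun I => (h1 I).symm, isRealSpinor_toSpinor fun I => (h2 I).symm,
      isRealSpinor_toSpinor fun I => (h3 I).symm, isRealSpinor_toSpinor fun I => (h4 I).symm⟩
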